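/- **Proposition 5 (Asymptotic Optimal Ranking).** Let $(\theta_i,Z_i)$, $i\ge 1$, be i.i.d. from the two-group model: $\theta_i\sim\mathrm{Bernoulli}(\pi)$ with $\pi\in[0,1]$, and given $\theta_i$ the real variable $Z_i$ has density $f_0$ if $\theta_i=0$ (null true) and $f_1$ if $\theta_i=1$. Write $T_i=\mathrm{lfdr}(Z_i)=(1-\pi)f_0(Z_i)/\{(1-\pi)f_0(Z_i)+\pi f_1(Z_i)\}$. For each $m$, let $\hat T_i=\hat T_{m,i}(Z_1,\dots,Z_m)\in[0,1]$, $i\le m$, be measurable estimates of the $T_i$ that are consistent: for all $\varepsilon>0$, $\max_{i\le m}P(|T_i-\hat T_i|\ge\varepsilon)\to0$ as $m\to\infty$. Let $\gamma,\alpha\in(0,1)$. For a vector $T\in[0,1]^m$ of statistics let $R_k(T)$ be the set of the $k$ indices with the smallest values of $T$ (ties broken by index), and let $X_k(T)$ be Poisson binomial, i.e. the number of successes in independent Bernoulli trials with success probabilities $T_i$, $i\in R_k(T)$. For a decision vector $\delta=(\delta_i)_{i\le m}$, $\mathrm{ETP}(\delta)=E\sum_i\theta_i\delta_i$ and $\mathrm{FDP}(\delta)=\sum_i(1-\theta_i)\delta_i/\{(\sum_i\delta_i)\vee1\}$;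 the expected scaled regret of $\delta'$ relative to $\delta$ is $m^{-1}E\{\sum_i\theta_i\delta_i-\sum_i\theta_i\delta'_i\}$. (a) For all measurable data-dependent $k=k_m(Z_1,\dots,Z_m)\in\{0,1,2,\dots\}$, the expected scaled regret of rejecting $R_k(\hat T)$ relative to rejecting $R_k(T)$ tends to $0$ as $m\to\infty$. (b) Suppose moreover that $P(T_1<\gamma)>0$. Let the oracle procedure reject $R_{K}(T)$ with $K=\max\{0\le k\le m: P(X_k(T)>\gamma k\mid T)\le\alpha\}$; its randomized version rejects in addition, if $K<m$, the hypothesis with the $(K+1)$-st smallest $T_i$ with conditional probability $(\alpha-p_K)/(p_{K+1}-p_K)$ given the data, where $p_k=P(X_k(T)>\gamma k\mid T)$. Let $\eta_m\ge0$ be any deterministic sequence with $\eta_m\to0$, and let the relaxed data-driven procedure $\delta^{DDr}$ reject $R_{K'}(\hat T)$ with $$K'=\max\{0\le k\le m:\ P(X_k(\hat T)/(k\vee1)\ge\gamma+\varepsilon\mid \hat T)\le\alpha+\eta_m\ \text{ for all }\varepsilon>0\}.$$ Then, as $m\to\infty$: 1. $\delta^{DDr}$ is asymptotically valid: for every $\varepsilon>0$,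 $P(\mathrm{FDP}(\delta^{DDr})\ge\gamma+\varepsilon)\le\alpha+o(1)$; 2. $\mathrm{ETP}(\delta^{OR})=\mathrm{ETP}(\delta^{DDr})\,(1+o(1))$, where $\delta^{OR}$ is the oracle procedure, without or with the randomization; 3. the expected scaled regret of $\delta^{DDr}$ relative to $\delta^{OR}$ (without or with the randomization) is $o(1)$. -/

import Mathlib

open MeasureTheory ProbabilityTheory Filter Asymptotics
open scoped Topology

namespace FDX

noncomputable section

/-- `f` is a probability density on the real line. -/
structure IsDensity (f : ℝ → ℝ) : Prop where
  measurable : Measurable f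
  nonneg : ∀ x, 0 ≤ f x
  lintegral_eq_one : ∫⁻ x, ENNReal.ofReal (f x) = 1

/-- Joint law of one pair `(θ, Z)` in the two-group model: `θ ∼ Bernoulli(prob)`, and given `θ`
the variable `Z` has density `f₀` if `θ = 0` and `f₁` if `θ = 1`. -/
def twoGroupLaw (prob : ℝ) (f₀ f₁ : ℝ → ℝ) : Measure (ℝ × ℝ) :=
  ENNReal.ofReal (1 - prob) •
      (Measure.dirac (0 : ℝ)).prod (volume.withDensity fun x => ENNReal.ofReal (f₀ x)) +
    ENNReal.ofReal prob •
      (Measure.dirac (1 : ℝ)).prod (volume.withDensity fun x => ENNReal.ofReal (f₁ x))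

/-- The pairs `(θ i, Z i)` are i.i.d. from the two-group model. The testing problem with `m`
hypotheses uses the first `m` pairs. -/
structure IsTwoGroupModel {Ω : Type*} [MeasurableSpace Ω] (P : Measure Ω)
    (prob : ℝ) (f₀ f₁ : ℝ → ℝ) (θ Z : ℕ → Ω → ℝ) : Prop where
  measurable_theta : ∀ i, Measurable (θ i)
  measurable_Z : ∀ i, Measurable (Z i)
  indep : iIndepFun (fun i ω => (θ i ω, Z i ω)) P
  law : ∀ i, P.map (fun ω => (θ i ω, Z i ω)) = twoGroupLaw prob f₀ f₁

/-- The first `m` terms of a sequence of random variables, at the sample point `ω`. -/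
def sample {Ω : Type*} (X : ℕ → Ω → ℝ) (m : ℕ) (ω : Ω) : Fin m → ℝ := fun i => X i ω

/-- Local false discovery rate `(1 - prob) f₀(z) / f(z)`, where `f = (1 - prob) f₀ + prob f₁`. -/
def lfdr (prob : ℝ) (f₀ f₁ : ℝ → ℝ) (z : ℝ) : ℝ :=
  (1 - prob) * f₀ z / ((1 - prob) * f₀ z + prob * f₁ z)

/-- The vector of oracle statistics computed from the data `z`. -/
def oracleStat (prob : ℝ) (f₀ f₁ : ℝ → ℝ) (m : ℕ) (z : Fin m → ℝ) : Fin m → ℝ :=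
  fun i => lfdr prob f₀ f₁ (z i)

/-- Zero-based position of `i` when `T` is sorted in ascending order; ties are broken by index. -/
def rank {m : ℕ} (T : Fin m → ℝ) (i : Fin m) : ℕ :=
  (Finset.univ.filter fun j : Fin m => T j < T i ∨ (T j = T i ∧ j < i)).card

/-- The indices of the `k` smallest values of `T`. -/
def topSet {m : ℕ} (T : Fin m → ℝ) (k : ℕ) : Finset (Fin m) :=
  Finset.univ.filter fun i => rank T i < k

/-- The decision vector that rejects the `k` hypotheses with the smallest values of `T`. -/
def topRule {m : ℕ} (T : Fin m → ℝ) (k : ℕ) : Fin m → ℝ :=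
  fun i => if rank T i < k then 1 else 0

/-- Probability that a Poisson binomial variable (the number of successes in independent
Bernoulli trials indexed by `S`, with success probabilities `p i`) lies in `E`. -/
def pbdProb {ι : Type*} [DecidableEq ι] (p : ι → ℝ) (S : Finset ι) (E : Set ℕ) : ℝ :=
  open Classical in
  ∑ A ∈ S.powerset.filter (fun A => A.card ∈ E), (∏ i ∈ A, p i) * ∏ i ∈ S \ A, (1 - p i)

/-- `P(PBD(k, (T₍₁₎, …, T₍ₖ₎)) > γ k)`: conditional probability, if the null probabilities are the
`T i`, that rejecting the top `k` hypotheses gives an FDP above `γ`. -/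
def tailProb {m : ℕ} (T : Fin m → ℝ) (γ : ℝ) (k : ℕ) : ℝ :=
  pbdProb T (topSet T k) {x | γ * k < x}

/-- Number of rejections of the FDX procedure at level `(γ, α)` based on `T`:
the largest `k ≤ m` such that `P(PBD(k, (T₍₁₎, …, T₍ₖ₎)) > γ k) ≤ α`. -/
def stepUpCount {m : ℕ} (T : Fin m → ℝ) (γ α : ℝ) : ℕ :=
  open Classical in
  Nat.findGreatest (fun k => tailProb T γ k ≤ α) m

/-- Number of rejections of the relaxed procedure: the largest `k ≤ m` such that, computed with
the null probabilities `T i`, the FDP of the top-`k` rule satisfies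
`P(FDP(k) ≥ γ + ε) ≤ α + η` for all `ε > 0`. -/
def relaxedCount {m : ℕ} (T : Fin m → ℝ) (γ α η : ℝ) : ℕ :=
  open Classical in
  Nat.findGreatest
    (fun k => ∀ ε : ℝ, 0 < ε →
      pbdProb T (topSet T k) {x | γ + ε ≤ (x : ℝ) / max (k : ℝ) 1} ≤ α + η) m

/-- The FDX procedure based on `T`: reject the top `K` hypotheses. -/
def stepUpRule {m : ℕ} (T : Fin m → ℝ) (γ α : ℝ) : Fin m → ℝ :=
  topRule T (stepUpCount T γ α)

/-- The randomized version, which moreover rejects the hypothesis in position `K + 1` (if there is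
one) with the probability that exhausts the level `α`. The entries are the conditional rejection
probabilities given the data. -/
def randomizedRule {m : ℕ} (T : Fin m → ℝ) (γ α : ℝ) : Fin m → ℝ := fun i =>
  if rank T i < stepUpCount T γ α then 1
  else if rank T i = stepUpCount T γ α then
    (α - tailProb T γ (stepUpCount T γ α)) /
      (tailProb T γ (stepUpCount T γ α + 1) - tailProb T γ (stepUpCount T γ α))
  else 0

/-- The relaxed procedure based on `T`. -/
def relaxedRule {m : ℕ} (T : Fin m → ℝ) (γ α η : ℝ) : Fin m → ℝ :=
  topRule T (relaxedCount T γ α η)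

/-- False discovery proportion of the decision vector `δ`. -/
def fdp {m : ℕ} (θ δ : Fin m → ℝ) : ℝ :=
  (∑ i, (1 - θ i) * δ i) / max (∑ i, δ i) 1

/-- Expected number of true positives of the decision rule `δ`, a function of the data. -/
def etp {Ω : Type*} [MeasurableSpace Ω] (P : Measure Ω) (θ Z : ℕ → Ω → ℝ) (m : ℕ)
    (δ : (Fin m → ℝ) → Fin m → ℝ) : ℝ :=
  ∫ ω, ∑ i, sample θ m ω i * δ (sample Z m ω) i ∂P

/-- Expected scaled regret `m⁻¹ E(∑ θᵢ δᵢ - ∑ θᵢ δ'ᵢ)` of the rule `δ'` relative to `δ`. -/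
def regret {Ω : Type*} [MeasurableSpace Ω] (P : Measure Ω) (θ Z : ℕ → Ω → ℝ) (m : ℕ)
    (δ δ' : (Fin m → ℝ) → Fin m → ℝ) : ℝ :=
  (m : ℝ)⁻¹ * ∫ ω, (∑ i, sample θ m ω i * δ (sample Z m ω) i -
    ∑ i, sample θ m ω i * δ' (sample Z m ω) i) ∂P

/-- An estimator of the lfdr statistics: for each `m`, a measurable function of the `m` observations
whose values are vectors of probabilities. -/
structure IsLfdrEstimator (That : (m : ℕ) → (Fin m → ℝ) → Fin m → ℝ) : Prop where
  measurable : ∀ m, Measurable (That m)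
  mem_Icc : ∀ m z i, That m z i ∈ Set.Icc (0 : ℝ) 1

/-- Consistency: `|T̂ᵢ - Tᵢ| = o_P(1)` as `m → ∞`, uniformly in `i`. -/
def IsConsistent {Ω : Type*} [MeasurableSpace Ω] (P : Measure Ω) (Z : ℕ → Ω → ℝ)
    (prob : ℝ) (f₀ f₁ : ℝ → ℝ) (That : (m : ℕ) → (Fin m → ℝ) → Fin m → ℝ) : Prop :=
  ∀ ε : ℝ, 0 < ε → ∀ δ : ℝ, 0 < δ → ∀ᶠ m in atTop, ∀ i : Fin m,
    P.real {ω | ε ≤ |oracleStat prob f₀ f₁ m (sample Z m ω) i - That m (sample Z m ω) i|} ≤ δ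

end

end FDX

/-! Write `T` for the lfdr statistics and `T'` for their estimates. The residual `θ i - (1 - T i)`
is orthogonal to functions of the data and of the other `θ j`. Hence an ETP is the integral of `∑ (1
- T i) δ i`, so regrets compare functions of the data alone, and the number of true positives
deviates from this sum by `O(√m)` in mean square.

Rankings are compared through sums, never through the sets themselves: the top `k` set minimizes the
sum of its statistics, so ranking by `T'` costs at most `2 ∑ |T i - T' i|`
(`abs_sum_topRule_sub_le`). Consistency and boundedness make this `o(m)` in mean, which is part (a).

For part (b), consider `excess T γ k`, the sum of `T i - γ` over the top `k`. By Chebyshev, a tail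
probability at most `β` forces the excess to be at most `t`, and one above `β` forces it to be at
least `-t`, once `m / t ^ 2` is small. With `t` a small multiple of `m`, the level `β` is
immaterial: every step-up count sits where the excess returns to zero, up to `O(t)`, or at `m`. The
excess is convex in `k`, and by the law of large numbers it first dips to a negative multiple of
`m`, since a positive fraction of the `T i` is below `γ - ρ`. It therefore returns to zero with
slope bounded below, so its crossing is stable under estimation error and under the relaxation `η`
(`stepUp_stability`).

Thus, with probability tending to one, both procedures make nearly the same number of rejections,
the relaxed one makes at least `c * m`, and the average `T i` over its rejections is at most `γ +
o(1)`. This gives vanishing regret and an ETP of order `m`, hence equivalent ETPs. With the `O(√m)`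
noise bound, the probability that the FDP reaches `γ + ε` even tends to zero. -/

namespace FDX

/-! ### Ranking, top-`k` sets and the convex excess function. -/

section Ranking

variable {m : ℕ}

lemma rank_lt_rank {T : Fin m → ℝ} {i j : Fin m} (h : T i < T j ∨ (T i = T j ∧ i < j)) :
    rank T i < rank T j := by
  unfold rank
  apply Finset.card_lt_card
  rw [Finset.ssubset_iff_of_subset]
  · exact ⟨i, by simpa using h, by simp⟩
  · intro l hl
    simp only [Finset.mem_filter, Finset.mem_univ, true_and] at hl ⊢
    rcases hl with hl | ⟨hl, hl'⟩ <;> rcases h with h | ⟨h, h'⟩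
    · exact Or.inl (hl.trans h)
    · exact Or.inl (h ▸ hl)
    · exact Or.inl (hl ▸ h)
    · exact Or.inr ⟨hl.trans h, hl'.trans h'⟩

lemma le_of_rank_lt {T : Fin m → ℝ} {i j : Fin m} (h : rank T i < rank T j) : T i ≤ T j := by
  by_contra! hlt
  exact absurd (rank_lt_rank (Or.inl hlt)) h.not_gt

lemma rank_injective (T : Fin m → ℝ) : Function.Injective (rank T) := by
  intro i j hij
  by_contra hne
  rcases lt_trichotomy (T i) (T j) with h | h | h
  · exact (rank_lt_rank (Or.inl h)).ne hij
  · rcases lt_or_gt_of_ne hne with h' | h'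
    · exact (rank_lt_rank (Or.inr ⟨h, h'⟩)).ne hij
    · exact (rank_lt_rank (Or.inr ⟨h.symm, h'⟩)).ne hij.symm
  · exact (rank_lt_rank (Or.inl h)).ne hij.symm

lemma rank_lt (T : Fin m → ℝ) (i : Fin m) : rank T i < m := by
  unfold rank
  calc _ < (Finset.univ : Finset (Fin m)).card := by
        apply Finset.card_lt_card
        rw [Finset.ssubset_iff_of_subset (Finset.filter_subset _ _)]
        exact ⟨i, Finset.mem_univ _, by simp⟩
    _ = m := by simp

lemma mem_topSet {T : Fin m → ℝ} {k : ℕ} {i : Fin m} : i ∈ topSet T k ↔ rank T i < k := by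
  simp [topSet]

lemma card_topSet (T : Fin m → ℝ) {k : ℕ} (hk : k ≤ m) : (topSet T k).card = k := by
  have hinj : Function.Injective (fun i : Fin m => (⟨rank T i, rank_lt T i⟩ : Fin m)) :=
    fun i j h => rank_injective T (by simpa using h)
  have hsurj := Finite.surjective_of_injective hinj
  have : (topSet T k).image (rank T) = Finset.range k := by
    ext n
    simp only [Finset.mem_image, mem_topSet, Finset.mem_range]
    constructor
    · rintro ⟨i, hi, rfl⟩; exact hi
    · intro hn
      obtain ⟨i, hi⟩ := hsurj ⟨n, hn.trans_le hk⟩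
      have hi' : rank T i = n := by simpa using hi
      exact ⟨i, hi' ▸ hn, hi'⟩
  rw [← Finset.card_image_of_injective _ (rank_injective T), this, Finset.card_range]

lemma topSet_eq_univ (T : Fin m → ℝ) {k : ℕ} (hk : m ≤ k) : topSet T k = Finset.univ := by
  ext i
  simpa [mem_topSet] using (rank_lt T i).trans_le hk

lemma card_topSet_eq (T T' : Fin m → ℝ) (k : ℕ) : (topSet T k).card = (topSet T' k).card := by
  rcases le_total k m with hk | hk
  · rw [card_topSet T hk, card_topSet T' hk]
  · rw [topSet_eq_univ T hk, topSet_eq_univ T' hk]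

lemma topSet_mono (T : Fin m → ℝ) {k l : ℕ} (h : k ≤ l) : topSet T k ⊆ topSet T l := by
  intro i
  simp only [mem_topSet]
  exact fun hi => hi.trans_le h

/-- The smallest unselected value separates the two groups; the exchange and convexity arguments
both rest on such a threshold. -/
lemma exists_threshold (T : Fin m → ℝ) (k : ℕ) :
    ∃ t, (∀ i ∈ topSet T k, T i ≤ t) ∧ ∀ i ∉ topSet T k, t ≤ T i := by
  by_cases h : ((topSet T k)ᶜ).Nonempty
  · obtain ⟨j, hj, hmin⟩ := Finset.exists_min_image _ T h
    rw [Finset.mem_compl, mem_topSet, not_lt] at hj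
    refine ⟨T j, fun i hi => le_of_rank_lt ((mem_topSet.1 hi).trans_le hj), fun i hi => ?_⟩
    exact hmin i (Finset.mem_compl.2 hi)
  · rw [Finset.not_nonempty_iff_eq_empty, Finset.compl_eq_empty_iff] at h
    -- Everything is selected, so any upper bound of `T` serves.
    refine ⟨∑ i, |T i|, fun i _ => ?_, fun i hi => absurd (Finset.mem_univ i) (h ▸ hi)⟩
    exact (le_abs_self _).trans
      (Finset.single_le_sum (f := fun i => |T i|) (fun _ _ => abs_nonneg _) (Finset.mem_univ i))

/-- The top `k` hypotheses minimize the sum of the statistics among all sets of the same size. -/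
lemma sum_topSet_le (T : Fin m → ℝ) (k : ℕ) (A : Finset (Fin m))
    (hA : A.card = (topSet T k).card) : ∑ i ∈ topSet T k, T i ≤ ∑ i ∈ A, T i := by
  obtain ⟨t, h1, h2⟩ := exists_threshold T k
  -- After subtracting `t`, selected terms are nonpositive and unselected ones nonnegative; equal
  -- cardinalities allow `t` to be removed at the end.
  have key : ∑ i ∈ topSet T k, (T i - t) ≤ ∑ i ∈ A, (T i - t) := by
    calc ∑ i ∈ topSet T k, (T i - t) ≤ ∑ i ∈ topSet T k ∩ A, (T i - t) := by
          rw [← Finset.sum_inter_add_sum_sdiff (topSet T k) A]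
          have : ∑ i ∈ topSet T k \ A, (T i - t) ≤ 0 :=
            Finset.sum_nonpos fun i hi => sub_nonpos.2 (h1 i (Finset.mem_sdiff.1 hi).1)
          linarith
      _ ≤ ∑ i ∈ A, (T i - t) := by
          rw [← Finset.sum_inter_add_sum_sdiff A (topSet T k), Finset.inter_comm]
          have : 0 ≤ ∑ i ∈ A \ topSet T k, (T i - t) :=
            Finset.sum_nonneg fun i hi => sub_nonneg.2 (h2 i (Finset.mem_sdiff.1 hi).2)
          linarith
  simp only [Finset.sum_sub_distrib, Finset.sum_const, hA] at key
  linarith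

lemma sum_le_sum_add_dist (T T' : Fin m → ℝ) (A : Finset (Fin m)) :
    ∑ i ∈ A, T i ≤ ∑ i ∈ A, T' i + ∑ i, |T i - T' i| := by
  have h : ∑ i ∈ A, (T i - T' i) ≤ ∑ i, |T i - T' i| :=
    (Finset.sum_le_sum fun i _ => le_abs_self _).trans
      (Finset.sum_le_sum_of_subset_of_nonneg (Finset.subset_univ A) fun _ _ _ => abs_nonneg _)
  rw [Finset.sum_sub_distrib] at h
  linarith

lemma dist_comm_sum (T T' : Fin m → ℝ) : ∑ i, |T i - T' i| = ∑ i, |T' i - T i| :=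
  Finset.sum_congr rfl fun _ _ => abs_sub_comm _ _

/-- Sum of `T i - γ` over the top `k` hypotheses. -/
noncomputable def excess (T : Fin m → ℝ) (γ : ℝ) (k : ℕ) : ℝ := ∑ i ∈ topSet T k, (T i - γ)

lemma excess_eq (T : Fin m → ℝ) (γ : ℝ) {k : ℕ} (hk : k ≤ m) :
    excess T γ k = ∑ i ∈ topSet T k, T i - γ * k := by
  rw [excess, Finset.sum_sub_distrib, Finset.sum_const, card_topSet T hk, nsmul_eq_mul, mul_comm]

lemma excess_le_sum (T : Fin m → ℝ) (γ : ℝ) (A : Finset (Fin m)) :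
    excess T γ A.card ≤ ∑ i ∈ A, (T i - γ) := by
  have hA : A.card ≤ m := by simpa using Finset.card_le_univ A
  have := sum_topSet_le T A.card A (card_topSet T hA).symm
  rw [excess_eq T γ hA, Finset.sum_sub_distrib, Finset.sum_const, nsmul_eq_mul]
  linarith

/-- The top set of `T'` is a competitor of the same size in the minimization for `T`, and on a fixed
set the two sums differ by at most the total error. -/
lemma excess_le_excess_add (T T' : Fin m → ℝ) (γ : ℝ) {k : ℕ} (hk : k ≤ m) :
    excess T γ k ≤ excess T' γ k + ∑ i, |T i - T' i| := by
  have h1 := sum_topSet_le T k (topSet T' k) (card_topSet_eq T' T k)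
  have h2 := sum_le_sum_add_dist T T' (topSet T' k)
  rw [excess_eq T γ hk, excess_eq T' γ hk]
  linarith

lemma excess_succ_le {T : Fin m → ℝ} (hT : ∀ i, T i ∈ Set.Icc (0 : ℝ) 1) {γ : ℝ} (hγ : 0 ≤ γ)
    {k : ℕ} (hk : k < m) : excess T γ (k + 1) ≤ excess T γ k + 1 := by
  have hsub := topSet_mono T (Nat.le_succ k)
  have hcard : (topSet T (k + 1) \ topSet T k).card = 1 := by
    rw [Finset.card_sdiff_of_subset hsub, card_topSet T hk, card_topSet T hk.le]; omega
  have h : ∑ i ∈ topSet T (k + 1) \ topSet T k, (T i - γ) ≤ 1 := by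
    calc _ ≤ ∑ i ∈ topSet T (k + 1) \ topSet T k, (1 : ℝ) :=
          Finset.sum_le_sum fun i _ => by linarith [(hT i).2]
      _ = 1 := by simp [hcard]
  unfold excess
  rw [← Finset.sum_sdiff hsub]
  linarith

/-- Convexity of the excess: if it is at least `s` higher at `k` than at `k₀`, its slope
beyond `k` is at least `s / m`. -/
lemma excess_slope (T : Fin m → ℝ) (γ : ℝ) {k₀ k l : ℕ} (h0 : k₀ ≤ k) (hkl : k ≤ l) (hl : l ≤ m)
    {s : ℝ} (hs : 0 < s) (h : excess T γ k₀ + s * m ≤ excess T γ k) :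
    s * ((l : ℝ) - k) ≤ excess T γ l - excess T γ k := by
  obtain ⟨t, h1, h2⟩ := exists_threshold T k
  have hsub0 := topSet_mono T h0
  have hsub := topSet_mono T hkl
  have c0 : ((topSet T k \ topSet T k₀).card : ℝ) = k - k₀ := by
    rw [Finset.card_sdiff_of_subset hsub0, card_topSet T (hkl.trans hl),
      card_topSet T (h0.trans (hkl.trans hl)), Nat.cast_sub h0]
  have c1 : ((topSet T l \ topSet T k).card : ℝ) = l - k := by
    rw [Finset.card_sdiff_of_subset hsub, card_topSet T hl, card_topSet T (hkl.trans hl),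
      Nat.cast_sub hkl]
  have hlow : ∑ i ∈ topSet T k \ topSet T k₀, (T i - γ) ≤ ((k : ℝ) - k₀) * (t - γ) := by
    rw [← c0, ← nsmul_eq_mul, ← Finset.sum_const]
    exact Finset.sum_le_sum fun i hi => by linarith [h1 i (Finset.mem_sdiff.1 hi).1]
  have hup : ((l : ℝ) - k) * (t - γ) ≤ ∑ i ∈ topSet T l \ topSet T k, (T i - γ) := by
    rw [← c1, ← nsmul_eq_mul, ← Finset.sum_const]
    exact Finset.sum_le_sum fun i hi => by linarith [h2 i (Finset.mem_sdiff.1 hi).2]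
  have e0 : excess T γ k = ∑ i ∈ topSet T k \ topSet T k₀, (T i - γ) + excess T γ k₀ :=
    (Finset.sum_sdiff hsub0).symm
  have e1 : excess T γ l = ∑ i ∈ topSet T l \ topSet T k, (T i - γ) + excess T γ k :=
    (Finset.sum_sdiff hsub).symm
  have hk0 : (k₀ : ℝ) ≤ k := by exact_mod_cast h0
  have hkl' : (k : ℝ) ≤ l := by exact_mod_cast hkl
  have hlm : (l : ℝ) ≤ m := by exact_mod_cast hl
  have hk00 : (0 : ℝ) ≤ k₀ := Nat.cast_nonneg _
  rcases eq_or_lt_of_le hkl' with heq | hlt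
  · have hz : (l : ℝ) - k = 0 := by linarith
    rw [hz] at hup ⊢
    linarith
  -- At most `m` terms, each at most `t - γ`, produce a rise of `s * m`; all later terms are at
  -- least `t - γ`. The case `k = l` was split off because `k < l` ensures `0 < m`.
  have hst : s ≤ t - γ := by
    by_contra! hcon
    have : 0 < s * m := by nlinarith
    nlinarith
  rw [e1]
  nlinarith

lemma sum_mul_topRule (w : Fin m → ℝ) (T : Fin m → ℝ) (k : ℕ) :
    ∑ i, w i * topRule T k i = ∑ i ∈ topSet T k, w i := by
  simp [topRule, topSet, Finset.sum_filter]

lemma sum_topRule (T : Fin m → ℝ) {k : ℕ} (hk : k ≤ m) : ∑ i, topRule T k i = k := by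
  simpa [card_topSet T hk] using sum_mul_topRule (fun _ => 1) T k

lemma topRule_mem_Icc (T : Fin m → ℝ) (k : ℕ) (i : Fin m) : topRule T k i ∈ Set.Icc (0 : ℝ) 1 := by
  unfold topRule
  split_ifs <;> simp

/-- Replacing the statistics by estimates in the top-`k` rule costs at most twice the total
estimation error. -/
lemma abs_sum_topRule_sub_le (T T' : Fin m → ℝ) (k : ℕ) :
    |∑ i, (1 - T i) * topRule T k i - ∑ i, (1 - T i) * topRule T' k i|
      ≤ 2 * ∑ i, |T i - T' i| := by
  -- Passing from `T` to `T'` costs one total error, optimality of the other top set is free, and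
  -- passing back costs a second.
  have h1 := sum_topSet_le T k (topSet T' k) (card_topSet_eq T' T k)
  have h2 := sum_topSet_le T' k (topSet T k) (card_topSet_eq T T' k)
  have h3 := sum_le_sum_add_dist T T' (topSet T' k)
  have h4 := sum_le_sum_add_dist T' T (topSet T k)
  rw [dist_comm_sum] at h4
  have h5 : 0 ≤ ∑ i, |T i - T' i| := Finset.sum_nonneg fun _ _ => abs_nonneg _
  simp only [sum_mul_topRule, Finset.sum_sub_distrib, Finset.sum_const, card_topSet_eq T' T k]
  rw [abs_le]
  constructor <;> linarith

lemma abs_sum_topRule_sub_topRule_le {T : Fin m → ℝ} (hT : ∀ i, T i ∈ Set.Icc (0 : ℝ) 1)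
    {k l : ℕ} (hk : k ≤ m) (hl : l ≤ m) :
    |∑ i, (1 - T i) * topRule T k i - ∑ i, (1 - T i) * topRule T l i| ≤ |(k : ℝ) - l| := by
  wlog hkl : k ≤ l generalizing k l
  · rw [abs_sub_comm, abs_sub_comm (k : ℝ)]
    exact this hl hk (le_of_not_ge hkl)
  have hsub := topSet_mono T hkl
  have c1 : ((topSet T l \ topSet T k).card : ℝ) = l - k := by
    rw [Finset.card_sdiff_of_subset hsub, card_topSet T hl, card_topSet T hk, Nat.cast_sub hkl]
  rw [sum_mul_topRule, sum_mul_topRule, abs_sub_comm, abs_sub_comm (k : ℝ),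
    ← Finset.sum_sdiff hsub, add_sub_cancel_right, ← c1, Nat.abs_cast]
  refine (Finset.abs_sum_le_sum_abs _ _).trans ?_
  calc _ ≤ ∑ i ∈ topSet T l \ topSet T k, (1 : ℝ) := Finset.sum_le_sum fun i _ => by
        rw [abs_le]; constructor <;> linarith [(hT i).1, (hT i).2]
    _ = _ := by simp

end Ranking

/-! ### Moments and tails of the Poisson binomial distribution. -/

section PoissonBinomial

variable {ι : Type*} [DecidableEq ι]

/-- Probability that exactly the trials in `A` are successes. -/
noncomputable def pbdWeight (p : ι → ℝ) (S A : Finset ι) : ℝ :=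
  (∏ i ∈ A, p i) * ∏ i ∈ S \ A, (1 - p i)

lemma pbdWeight_nonneg {p : ι → ℝ} (hp : ∀ i, p i ∈ Set.Icc (0 : ℝ) 1) (S A : Finset ι) :
    0 ≤ pbdWeight p S A :=
  mul_nonneg (Finset.prod_nonneg fun i _ => (hp i).1)
    (Finset.prod_nonneg fun i _ => sub_nonneg.2 (hp i).2)

lemma sum_pbdWeight (p : ι → ℝ) (S : Finset ι) : ∑ A ∈ S.powerset, pbdWeight p S A = 1 := by
  have h := Finset.prod_add p (fun i => 1 - p i) S
  simp only [add_sub_cancel, Finset.prod_const_one] at h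
  exact h.symm

lemma pbdWeight_insert_of_notMem (p : ι → ℝ) {S A : Finset ι} {a : ι} (ha : a ∉ S) (hA : A ⊆ S) :
    pbdWeight p (insert a S) A = (1 - p a) * pbdWeight p S A := by
  have h1 : insert a S \ A = insert a (S \ A) :=
    Finset.insert_sdiff_of_notMem S fun h => ha (hA h)
  rw [pbdWeight, pbdWeight, h1, Finset.prod_insert (by simp [ha])]
  ring

lemma pbdWeight_insert_insert (p : ι → ℝ) {S A : Finset ι} {a : ι} (ha : a ∉ S) (hA : A ⊆ S) :
    pbdWeight p (insert a S) (insert a A) = p a * pbdWeight p S A := by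
  have h1 : insert a S \ insert a A = S \ A := by
    rw [Finset.insert_sdiff_insert, Finset.sdiff_insert_of_notMem ha]
  rw [pbdWeight, pbdWeight, h1, Finset.prod_insert fun h => ha (hA h)]
  ring

/-- Condition on the trial `a`: a success shifts the centre from `c` to `c - 1`, so the induction
needs an arbitrary centre. -/
lemma pbd_second_moment (p : ι → ℝ) (S : Finset ι) (c : ℝ) :
    ∑ A ∈ S.powerset, pbdWeight p S A * ((A.card : ℝ) - c) ^ 2 =
      ∑ i ∈ S, p i * (1 - p i) + (∑ i ∈ S, p i - c) ^ 2 := by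
  induction S using Finset.induction_on generalizing c with
  | empty => simp [pbdWeight]
  | insert a S ha ih =>
    have h1 : ∀ A ∈ S.powerset, pbdWeight p (insert a S) A * ((A.card : ℝ) - c) ^ 2 =
        (1 - p a) * (pbdWeight p S A * ((A.card : ℝ) - c) ^ 2) := fun A hA => by
      rw [pbdWeight_insert_of_notMem p ha (Finset.mem_powerset.1 hA)]; ring
    have h2 : ∀ A ∈ S.powerset,
        pbdWeight p (insert a S) (insert a A) * (((insert a A).card : ℝ) - c) ^ 2 =
        p a * (pbdWeight p S A * ((A.card : ℝ) - (c - 1)) ^ 2) := fun A hA => by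
      have hA' := Finset.mem_powerset.1 hA
      rw [pbdWeight_insert_insert p ha hA', Finset.card_insert_of_notMem fun h => ha (hA' h)]
      push_cast
      ring
    rw [Finset.sum_powerset_insert ha, Finset.sum_congr rfl h1, Finset.sum_congr rfl h2,
      ← Finset.mul_sum, ← Finset.mul_sum, ih, ih, Finset.sum_insert ha, Finset.sum_insert ha]
    ring

lemma pbdProb_eq (p : ι → ℝ) (S : Finset ι) (E : Set ℕ) [DecidablePred fun A : Finset ι => A.card ∈ E] :
    pbdProb p S E = ∑ A ∈ S.powerset.filter (fun A => A.card ∈ E), pbdWeight p S A := by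
  unfold pbdProb pbdWeight
  congr!

/-- Chebyshev's inequality for the Poisson binomial distribution. -/
lemma pbdProb_le_of_sq_le {p : ι → ℝ} (hp : ∀ i, p i ∈ Set.Icc (0 : ℝ) 1) (S : Finset ι)
    {E : Set ℕ} {t : ℝ} (ht : 0 < t) (hE : ∀ x ∈ E, t ^ 2 ≤ ((x : ℝ) - ∑ i ∈ S, p i) ^ 2) :
    pbdProb p S E ≤ S.card / t ^ 2 := by
  classical
  have h2 := pbd_second_moment p S (∑ i ∈ S, p i)
  rw [sub_self, zero_pow two_ne_zero, add_zero] at h2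
  rw [pbdProb_eq, le_div_iff₀ (by positivity), Finset.sum_mul]
  calc _ ≤ ∑ A ∈ S.powerset.filter (fun A => A.card ∈ E),
        pbdWeight p S A * ((A.card : ℝ) - ∑ i ∈ S, p i) ^ 2 :=
        Finset.sum_le_sum fun A hA => mul_le_mul_of_nonneg_left
          (hE _ (Finset.mem_filter.1 hA).2) (pbdWeight_nonneg hp S A)
    _ ≤ ∑ A ∈ S.powerset, pbdWeight p S A * ((A.card : ℝ) - ∑ i ∈ S, p i) ^ 2 :=
        Finset.sum_le_sum_of_subset_of_nonneg (Finset.filter_subset _ _)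
          fun A _ _ => mul_nonneg (pbdWeight_nonneg hp S A) (sq_nonneg _)
    _ = ∑ i ∈ S, p i * (1 - p i) := h2
    _ ≤ ∑ i ∈ S, (1 : ℝ) := Finset.sum_le_sum fun i _ => by nlinarith [(hp i).1, (hp i).2]
    _ = S.card := by simp

lemma pbdProb_add_compl (p : ι → ℝ) (S : Finset ι) (E : Set ℕ) :
    pbdProb p S E + pbdProb p S Eᶜ = 1 := by
  classical
  rw [pbdProb_eq, pbdProb_eq, ← sum_pbdWeight p S]
  simp only [Set.mem_compl_iff]
  exact Finset.sum_filter_add_sum_filter_not _ _ _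

lemma pbdProb_mono {p : ι → ℝ} (hp : ∀ i, p i ∈ Set.Icc (0 : ℝ) 1) (S : Finset ι)
    {E F : Set ℕ} (h : ∀ x ≤ S.card, x ∈ E → x ∈ F) : pbdProb p S E ≤ pbdProb p S F := by
  classical
  rw [pbdProb_eq, pbdProb_eq]
  refine Finset.sum_le_sum_of_subset_of_nonneg (fun A hA => ?_)
    fun A _ _ => pbdWeight_nonneg hp S A
  simp only [Finset.mem_filter, Finset.mem_powerset] at hA ⊢
  exact ⟨hA.1, h _ (Finset.card_le_card hA.1) hA.2⟩

lemma pbdProb_eq_zero (p : ι → ℝ) (S : Finset ι) {E : Set ℕ} (h : ∀ x ≤ S.card, x ∉ E) :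
    pbdProb p S E = 0 := by
  classical
  rw [pbdProb_eq]
  refine Finset.sum_eq_zero fun A hA => ?_
  simp only [Finset.mem_filter, Finset.mem_powerset] at hA
  exact absurd hA.2 (h _ (Finset.card_le_card hA.1))

end PoissonBinomial

/-! ### Step-up counts as approximate zeros of the excess. -/

section Counts

variable {m : ℕ}

lemma tailProb_zero (T : Fin m → ℝ) (γ : ℝ) : tailProb T γ 0 = 0 := by
  refine pbdProb_eq_zero _ _ fun x hx => ?_
  rw [card_topSet T (Nat.zero_le m)] at hx
  simp [Nat.le_zero.1 hx]

/-- The number of successes is an integer, so exceeding `γ k` means exceeding it by a fixed gap, and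
a single small `ε` already captures the strict tail. -/
lemma forall_pbdProb_le_iff {T : Fin m → ℝ} (hT : ∀ i, T i ∈ Set.Icc (0 : ℝ) 1) {γ : ℝ}
    (hγ : 0 < γ) {k : ℕ} (hk : k ≤ m) (β : ℝ) :
    (∀ ε : ℝ, 0 < ε → pbdProb T (topSet T k) {x | γ + ε ≤ (x : ℝ) / max (k : ℝ) 1} ≤ β) ↔
      tailProb T γ k ≤ β := by
  have hmax : (0 : ℝ) < max (k : ℝ) 1 := lt_max_of_lt_right one_pos
  constructor
  · intro h
    -- The gap from `γ k` to the next integer, divided by `max k 1`, is the `ε` to use.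
    have hfl : γ * k < ⌊γ * k⌋₊ + 1 := Nat.lt_floor_add_one _
    refine le_trans (pbdProb_mono hT _ fun x hx hxE => ?_)
      (h ((⌊γ * k⌋₊ + 1 - γ * k) / max (k : ℝ) 1) (div_pos (by linarith) hmax))
    rw [card_topSet T hk] at hx
    simp only [Set.mem_ofPred_eq] at hxE ⊢
    rcases Nat.eq_zero_or_pos k with rfl | hk0
    · simp [Nat.le_zero.1 hx] at hxE
    have hk1 : (1 : ℝ) ≤ k := by exact_mod_cast hk0
    have hx1 : ((⌊γ * k⌋₊ : ℝ) + 1) ≤ x := by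
      exact_mod_cast (Nat.floor_lt (by positivity)).2 hxE
    rw [max_eq_left hk1, le_div_iff₀ (by linarith), add_mul, div_mul_cancel₀ _ (by linarith)]
    linarith
  · intro h ε hε
    refine (pbdProb_mono hT _ fun x hx hxE => ?_).trans h
    simp only [Set.mem_ofPred_eq] at hxE ⊢
    rw [le_div_iff₀ hmax] at hxE
    calc γ * k ≤ γ * max (k : ℝ) 1 := mul_le_mul_of_nonneg_left (le_max_left _ _) hγ.le
      _ < (γ + ε) * max (k : ℝ) 1 := mul_lt_mul_of_pos_right (by linarith) hmax
      _ ≤ x := hxE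

lemma tailProb_stepUpCount_le (T : Fin m → ℝ) (γ : ℝ) {β : ℝ} (hβ : 0 ≤ β) :
    tailProb T γ (stepUpCount T γ β) ≤ β := by
  classical
  exact Nat.findGreatest_spec (P := fun k => tailProb T γ k ≤ β) (Nat.zero_le m)
    (by rwa [tailProb_zero])

lemma stepUpCount_le (T : Fin m → ℝ) (γ β : ℝ) : stepUpCount T γ β ≤ m :=
  Nat.findGreatest_le _

lemma le_stepUpCount {T : Fin m → ℝ} {γ β : ℝ} {k : ℕ} (hk : k ≤ m) (h : tailProb T γ k ≤ β) :
    k ≤ stepUpCount T γ β :=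
  Nat.le_findGreatest hk h

lemma lt_tailProb_of_stepUpCount_lt {T : Fin m → ℝ} {γ β : ℝ} {k : ℕ} (hk : k ≤ m)
    (h : stepUpCount T γ β < k) : β < tailProb T γ k := by
  by_contra! hcon
  exact absurd (le_stepUpCount hk hcon) h.not_ge

/-- The relaxed count is the step-up count at the relaxed level. -/
lemma relaxedCount_eq {T : Fin m → ℝ} (hT : ∀ i, T i ∈ Set.Icc (0 : ℝ) 1) {γ : ℝ}
    (hγ : 0 < γ) {α η : ℝ} (h0 : 0 ≤ α + η) :
    relaxedCount T γ α η = stepUpCount T γ (α + η) := by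
  classical
  apply le_antisymm
  · refine le_stepUpCount (Nat.findGreatest_le _) ?_
    refine (forall_pbdProb_le_iff hT hγ (Nat.findGreatest_le _) _).1 ?_
    refine Nat.findGreatest_spec (P := fun k => ∀ ε : ℝ, 0 < ε →
      pbdProb T (topSet T k) {x | γ + ε ≤ (x : ℝ) / max (k : ℝ) 1} ≤ α + η) (Nat.zero_le m) ?_
    exact (forall_pbdProb_le_iff hT hγ (Nat.zero_le m) _).2 (by rwa [tailProb_zero])
  · exact Nat.le_findGreatest (stepUpCount_le _ _ _)
      ((forall_pbdProb_le_iff hT hγ (stepUpCount_le _ _ _) _).2 (tailProb_stepUpCount_le T γ h0))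

/-- If the mean exceeded `γ k` by more than `t`, Chebyshev would make staying at or below `γ k` less
likely than `1 - β`. The level enters only through `m / t ^ 2`. -/
lemma excess_le_of_tailProb_le {T : Fin m → ℝ} (hT : ∀ i, T i ∈ Set.Icc (0 : ℝ) 1) {γ β t : ℝ}
    {k : ℕ} (hk : k ≤ m) (ht : 0 < t) (hm : m / t ^ 2 < 1 - β) (h : tailProb T γ k ≤ β) :
    excess T γ k ≤ t := by
  by_contra! hcon
  rw [excess_eq T γ hk] at hcon
  have h1 := pbdProb_add_compl T (topSet T k) {x | γ * k < x}
  have h2 : pbdProb T (topSet T k) {x | γ * k < x}ᶜ ≤ (topSet T k).card / t ^ 2 := by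
    refine pbdProb_le_of_sq_le hT _ ht fun x hx => ?_
    simp only [Set.mem_compl_iff, Set.mem_ofPred_eq, not_lt] at hx
    nlinarith
  have h3 : ((topSet T k).card : ℝ) / t ^ 2 ≤ m / t ^ 2 := by
    rw [card_topSet T hk]; gcongr
  have h4 : pbdProb T (topSet T k) {x | γ * k < x} ≤ β := h
  linarith

lemma neg_le_excess_of_lt_tailProb {T : Fin m → ℝ} (hT : ∀ i, T i ∈ Set.Icc (0 : ℝ) 1)
    {γ β t : ℝ} {k : ℕ} (hk : k ≤ m) (ht : 0 < t) (hm : m / t ^ 2 ≤ β) (h : β < tailProb T γ k) :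
    -t ≤ excess T γ k := by
  by_contra! hcon
  rw [excess_eq T γ hk] at hcon
  have h2 : pbdProb T (topSet T k) {x | γ * k < x} ≤ (topSet T k).card / t ^ 2 := by
    refine pbdProb_le_of_sq_le hT _ ht fun x hx => ?_
    simp only [Set.mem_ofPred_eq] at hx
    nlinarith
  have h3 : ((topSet T k).card : ℝ) / t ^ 2 ≤ m / t ^ 2 := by
    rw [card_topSet T hk]; gcongr
  have h4 : β < pbdProb T (topSet T k) {x | γ * k < x} := h
  linarith

/-- The number `k` of rejections nearly exhausts the budget: the excess is zero up to `u`, unless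
everything is rejected. -/
structure NearlyExhausts (T : Fin m → ℝ) (γ : ℝ) (k₀ : ℕ) (u : ℝ) (k : ℕ) : Prop where
  ge : k₀ ≤ k
  le : k ≤ m
  excess_le : excess T γ k ≤ u
  neg_le : k < m → -u ≤ excess T γ k

/-- If `k < l`, the excess at `k` is at least `-u ≥ -(s * m)`, a rise of `s * m` from `k₀`. By
convexity it then grows with slope at least `s`, while from `k` to `l` it can gain only `2 * u`. -/
lemma NearlyExhausts.sub_le {T : Fin m → ℝ} {γ u s : ℝ} {k₀ k l : ℕ}
    (hk : NearlyExhausts T γ k₀ u k) (hl : NearlyExhausts T γ k₀ u l) (hkl : k ≤ l) (hs : 0 < s)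
    (h0 : excess T γ k₀ ≤ -(2 * s * m)) (hu : 0 ≤ u) (hus : u ≤ s * m) :
    s * ((l : ℝ) - k) ≤ 2 * u := by
  rcases hkl.eq_or_lt with rfl | hlt
  · simpa using hu
  have h1 := hk.neg_le (hlt.trans_le hl.le)
  have := excess_slope T γ hk.ge hkl hl.le hs (by linarith)
  linarith [hl.excess_le]

lemma NearlyExhausts.abs_sub_le {T : Fin m → ℝ} {γ u s : ℝ} {k₀ k l : ℕ}
    (hk : NearlyExhausts T γ k₀ u k) (hl : NearlyExhausts T γ k₀ u l) (hs : 0 < s)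
    (h0 : excess T γ k₀ ≤ -(2 * s * m)) (hu : 0 ≤ u) (hus : u ≤ s * m) :
    |(k : ℝ) - l| ≤ 2 * u / s := by
  rw [le_div_iff₀ hs, mul_comm]
  rcases le_total k l with h | h
  · have hh : (k : ℝ) ≤ l := by exact_mod_cast h
    rw [abs_sub_comm, abs_of_nonneg (sub_nonneg.2 hh)]
    exact hk.sub_le hl h hs h0 hu hus
  · have hh : (l : ℝ) ≤ k := by exact_mod_cast h
    rw [abs_of_nonneg (sub_nonneg.2 hh)]
    exact hl.sub_le hk h hs h0 hu hus

/-- The step-up count computed from estimates `T'` of `T` nearly exhausts the budget of `T`. -/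
lemma nearlyExhausts_stepUpCount {T T' : Fin m → ℝ} (hT' : ∀ i, T' i ∈ Set.Icc (0 : ℝ) 1)
    {γ β t : ℝ} (hγ : 0 ≤ γ) (ht : 1 ≤ t) (hm₁ : m / t ^ 2 ≤ β) (hm₂ : m / t ^ 2 < 1 - β)
    (hdist : ∑ i, |T i - T' i| ≤ t) {k₀ : ℕ} (hk₀ : k₀ ≤ m)
    (h0 : excess T γ k₀ < -(2 * t)) :
    NearlyExhausts T γ k₀ (3 * t) (stepUpCount T' γ β) := by
  have ht0 : 0 < t := by linarith
  have hβ : 0 ≤ β := le_trans (by positivity) hm₁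
  have hK := stepUpCount_le T' γ β
  have hdist' : ∑ i, |T' i - T i| ≤ t := by rwa [dist_comm_sum]
  refine ⟨?_, hK, ?_, fun hlt => ?_⟩
  -- The excess of `T'` at `k₀` is below `-2t + t = -t`, too low for the criterion to fail there.
  · refine le_stepUpCount hk₀ ?_
    by_contra! hcon
    have h1 := neg_le_excess_of_lt_tailProb hT' hk₀ ht0 hm₁ hcon
    have h2 := excess_le_excess_add T' T γ hk₀
    linarith
  · have h1 := excess_le_of_tailProb_le hT' hK ht0 hm₂ (tailProb_stepUpCount_le T' γ hβ)
    have h2 := excess_le_excess_add T T' γ hK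
    linarith
  -- By maximality the criterion fails one step further, where the excess of `T'` is at least `-t`.
  -- Stepping back costs `1 ≤ t` and passing to `T` costs `t`, hence `3 * t`.
  · have h1 := neg_le_excess_of_lt_tailProb hT' (Nat.succ_le_of_lt hlt) ht0 hm₁
      (lt_tailProb_of_stepUpCount_lt (Nat.succ_le_of_lt hlt) (Nat.lt_succ_self _))
    have h2 := excess_succ_le hT' hγ hlt
    have h3 := excess_le_excess_add T' T γ hK
    linarith

lemma randomizedRule_sub_mem_Icc (T : Fin m → ℝ) (γ : ℝ) {α : ℝ} (hα : 0 ≤ α) (i : Fin m) :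
    randomizedRule T γ α i - stepUpRule T γ α i ∈ Set.Icc (0 : ℝ)
      (if rank T i = stepUpCount T γ α then 1 else 0) := by
  have h1 := tailProb_stepUpCount_le T γ hα
  unfold randomizedRule stepUpRule topRule
  split_ifs with h2 h3 h3
  · omega
  -- An index of rank `K` exists, so `K < m` and `p_K ≤ α < p_{K+1}`: the quotient is a probability.
  · have h4 := lt_tailProb_of_stepUpCount_lt (β := α) (h2 ▸ rank_lt T i : stepUpCount T γ α < m)
      (Nat.lt_succ_self _)
    rw [sub_zero]
    exact ⟨div_nonneg (by linarith) (by linarith), div_le_one_of_le₀ (by linarith) (by linarith)⟩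
  · simp
  · simp

lemma randomizedRule_mem_Icc (T : Fin m → ℝ) (γ : ℝ) {α : ℝ} (hα : 0 ≤ α) (i : Fin m) :
    randomizedRule T γ α i ∈ Set.Icc (0 : ℝ) 1 := by
  have h := randomizedRule_sub_mem_Icc T γ hα i
  have h1 := topRule_mem_Icc T (stepUpCount T γ α) i
  rw [← stepUpRule] at h1
  refine ⟨by linarith [h.1, h1.1], ?_⟩
  unfold stepUpRule topRule at h
  split_ifs at h
  · omega
  · linarith [h.2]
  · linarith [h.2]
  · linarith [h.2]

lemma abs_sum_randomizedRule_sub_le {T : Fin m → ℝ} (hT : ∀ i, T i ∈ Set.Icc (0 : ℝ) 1)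
    (γ : ℝ) {α : ℝ} (hα : 0 ≤ α) :
    |∑ i, (1 - T i) * randomizedRule T γ α i - ∑ i, (1 - T i) * stepUpRule T γ α i| ≤ 1 := by
  have hterm := randomizedRule_sub_mem_Icc T γ hα
  have hnn : 0 ≤ ∑ i, (1 - T i) * (randomizedRule T γ α i - stepUpRule T γ α i) :=
    Finset.sum_nonneg fun i _ => mul_nonneg (sub_nonneg.2 (hT i).2) (hterm i).1
  rw [← Finset.sum_sub_distrib]
  simp only [← mul_sub]
  rw [abs_of_nonneg hnn]
  calc _ ≤ ∑ i, (if rank T i = stepUpCount T γ α then (1 : ℝ) else 0) :=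
        Finset.sum_le_sum fun i _ => by nlinarith [(hT i).1, (hT i).2, (hterm i).1, (hterm i).2]
    _ = (Finset.univ.filter fun i => rank T i = stepUpCount T γ α).card := by simp
    _ ≤ 1 := by
        have : (Finset.univ.filter fun i => rank T i = stepUpCount T γ α).card ≤ 1 :=
          Finset.card_le_one.2 fun i hi j hj => rank_injective T (by
            simp only [Finset.mem_filter, Finset.mem_univ, true_and] at hi hj
            rw [hi, hj])
        exact_mod_cast this

end Counts

/-! ### Measurability of ranks, counts and rules. -/

section Measurability

variable {m : ℕ}

lemma measurable_rank (i : Fin m) : Measurable fun T : Fin m → ℝ => rank T i := by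
  unfold rank
  simp only [Finset.card_filter]
  refine Finset.measurable_fun_sum _ fun j _ => Measurable.ite ?_ measurable_const measurable_const
  have hj : Measurable fun T : Fin m → ℝ => T j := measurable_pi_apply j
  have hi : Measurable fun T : Fin m → ℝ => T i := measurable_pi_apply i
  exact (measurableSet_lt hj hi).union ((measurableSet_eq_fun hj hi).inter (.const _))

lemma measurableSet_topSet_eq (k : ℕ) (S : Finset (Fin m)) :
    MeasurableSet {T : Fin m → ℝ | topSet T k = S} := by
  have : {T : Fin m → ℝ | topSet T k = S} = ⋂ i, {T : Fin m → ℝ | rank T i < k ↔ i ∈ S} := by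
    ext T
    simp [Finset.ext_iff, mem_topSet]
  rw [this]
  refine MeasurableSet.iInter fun i => ?_
  have h := measurableSet_lt (measurable_rank i) (measurable_const (a := k))
  by_cases hi : i ∈ S
  · simpa only [hi, iff_true] using h
  · simp only [hi, iff_false]
    exact h.compl

lemma measurable_pbdProb {ι : Type*} [DecidableEq ι] (S : Finset ι) (E : Set ℕ) :
    Measurable fun p : ι → ℝ => pbdProb p S E := by
  unfold pbdProb
  fun_prop

/-- `topSet` takes finitely many values, each on a measurable set, and for a fixed set the
probability is a polynomial in `T`. -/
lemma measurable_pbdProb_topSet (k : ℕ) (E : Set ℕ) :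
    Measurable fun T : Fin m → ℝ => pbdProb T (topSet T k) E := by
  classical
  have : (fun T : Fin m → ℝ => pbdProb T (topSet T k) E) = fun T => ∑ S : Finset (Fin m),
      if topSet T k = S then pbdProb T S E else 0 := by
    ext T
    simp
  rw [this]
  exact Finset.measurable_fun_sum _ fun S _ =>
    Measurable.ite (measurableSet_topSet_eq k S) (measurable_pbdProb S E) measurable_const

lemma measurable_tailProb (γ : ℝ) (k : ℕ) : Measurable fun T : Fin m → ℝ => tailProb T γ k :=
  measurable_pbdProb_topSet k _

lemma measurable_stepUpCount (γ β : ℝ) : Measurable fun T : Fin m → ℝ => stepUpCount T γ β := by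
  classical
  unfold stepUpCount
  exact measurable_findGreatest fun k _ => measurableSet_le (measurable_tailProb γ k)
    measurable_const

lemma measurable_topRule {α : Type*} [MeasurableSpace α] {T : α → Fin m → ℝ} {k : α → ℕ}
    (hT : Measurable T) (hk : Measurable k) (i : Fin m) :
    Measurable fun z => topRule (T z) (k z) i := by
  unfold topRule
  exact Measurable.ite (measurableSet_lt ((measurable_rank i).comp hT) hk) measurable_const
    measurable_const

lemma measurable_apply_nat {α β : Type*} [MeasurableSpace α] [MeasurableSpace β]
    {f : ℕ → α → β} (hf : ∀ k, Measurable (f k)) {K : α → ℕ} (hK : Measurable K) :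
    Measurable fun a => f (K a) a := by
  have h : Measurable fun x : ℕ × α => f x.1 x.2 := measurable_from_prod_countable_right hf
  exact h.comp (hK.prodMk measurable_id)

lemma measurable_randomizedRule (γ α : ℝ) (i : Fin m) :
    Measurable fun T : Fin m → ℝ => randomizedRule T γ α i := by
  have hK := measurable_stepUpCount (m := m) γ α
  have hq : Measurable fun T : Fin m → ℝ => (α - tailProb T γ (stepUpCount T γ α)) /
      (tailProb T γ (stepUpCount T γ α + 1) - tailProb T γ (stepUpCount T γ α)) :=
    measurable_apply_nat (f := fun k (T : Fin m → ℝ) =>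
      (α - tailProb T γ k) / (tailProb T γ (k + 1) - tailProb T γ k))
      (fun k => (measurable_const.sub (measurable_tailProb γ k)).div
        ((measurable_tailProb γ (k + 1)).sub (measurable_tailProb γ k))) hK
  have hS1 := measurableSet_lt (measurable_rank i) hK
  have hS2 := measurableSet_eq_fun (measurable_rank i) hK
  unfold randomizedRule
  exact Measurable.ite hS1 measurable_const (Measurable.ite hS2 hq measurable_const)

end Measurability

/-! ### The two-group model and the orthogonality of residuals. -/

section Model

variable {prob : ℝ} {f₀ f₁ : ℝ → ℝ}

lemma lfdr_mem_Icc (hprob : prob ∈ Set.Icc (0 : ℝ) 1) (hf₀ : IsDensity f₀) (hf₁ : IsDensity f₁)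
    (z : ℝ) : lfdr prob f₀ f₁ z ∈ Set.Icc (0 : ℝ) 1 := by
  have h0 := mul_nonneg (sub_nonneg.2 hprob.2) (hf₀.nonneg z)
  have h1 := mul_nonneg hprob.1 (hf₁.nonneg z)
  exact ⟨div_nonneg h0 (by linarith), div_le_one_of_le₀ (by linarith) (by linarith)⟩

lemma measurable_lfdr (hf₀ : IsDensity f₀) (hf₁ : IsDensity f₁) :
    Measurable (lfdr prob f₀ f₁) := by
  have := hf₀.measurable
  have := hf₁.measurable
  unfold lfdr
  fun_prop

lemma measurable_oracleStat (hf₀ : IsDensity f₀) (hf₁ : IsDensity f₁) (m : ℕ) :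
    Measurable (oracleStat prob f₀ f₁ m) :=
  measurable_pi_iff.2 fun i => (measurable_lfdr hf₀ hf₁).comp (measurable_pi_apply i)

/-- Bayes' rule in product form. Where the mixture density vanishes so do both weighted densities,
so the value of `0 / 0` is harmless. -/
lemma lfdr_balance (hprob : prob ∈ Set.Icc (0 : ℝ) 1) (hf₀ : IsDensity f₀) (hf₁ : IsDensity f₁)
    (z : ℝ) :
    (1 - prob) * f₀ z * (1 - lfdr prob f₀ f₁ z) = prob * f₁ z * lfdr prob f₀ f₁ z := by
  have h0 := mul_nonneg (sub_nonneg.2 hprob.2) (hf₀.nonneg z)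
  have h1 := mul_nonneg hprob.1 (hf₁.nonneg z)
  unfold lfdr
  rcases eq_or_lt_of_le (add_nonneg h0 h1) with h | h
  · have h0' : (1 - prob) * f₀ z = 0 := by linarith
    have h1' : prob * f₁ z = 0 := by linarith
    simp [h0', h1']
  · field_simp
    ring

lemma IsDensity.isProbabilityMeasure {f : ℝ → ℝ} (hf : IsDensity f) :
    IsProbabilityMeasure (volume.withDensity fun x => ENNReal.ofReal (f x)) :=
  ⟨by rw [withDensity_apply _ MeasurableSet.univ, Measure.restrict_univ, hf.lintegral_eq_one]⟩

lemma IsDensity.integral_withDensity {f : ℝ → ℝ} (hf : IsDensity f) (g : ℝ → ℝ) :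
    ∫ x, g x ∂(volume.withDensity fun x => ENNReal.ofReal (f x)) = ∫ x, f x * g x := by
  rw [integral_withDensity_eq_integral_toReal_smul hf.measurable.ennreal_ofReal (by simp)]
  simp [ENNReal.toReal_ofReal, hf.nonneg]

/-- Under the two-group law, `1 - lfdr z` is the conditional mean of `θ` given `z`. -/
lemma integral_twoGroupLaw (hprob : prob ∈ Set.Icc (0 : ℝ) 1) (hf₀ : IsDensity f₀)
    (hf₁ : IsDensity f₁) {φ : ℝ → ℝ} (hφ : Measurable φ) {C : ℝ} (hC : ∀ z, |φ z| ≤ C) :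
    ∫ y, (y.1 - (1 - lfdr prob f₀ f₁ y.2)) * φ y.2 ∂(twoGroupLaw prob f₀ f₁) = 0 := by
  have := hf₀.isProbabilityMeasure
  have := hf₁.isProbabilityMeasure
  have hl := measurable_lfdr (prob := prob) hf₀ hf₁
  have hF : Measurable fun y : ℝ × ℝ => (y.1 - (1 - lfdr prob f₀ f₁ y.2)) * φ y.2 := by
    fun_prop
  have hmk (a : ℝ) : Measurable (Prod.mk a : ℝ → ℝ × ℝ) := measurable_prodMk_left
  have hint (a : ℝ) (ν : Measure ℝ) [IsProbabilityMeasure ν] :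
      Integrable (fun y : ℝ × ℝ => (y.1 - (1 - lfdr prob f₀ f₁ y.2)) * φ y.2)
        ((Measure.dirac a).prod ν) := by
    rw [Measure.dirac_prod, integrable_map_measure hF.aestronglyMeasurable (hmk a).aemeasurable]
    refine Integrable.of_bound (hF.comp (hmk a)).aestronglyMeasurable ((|a| + 1) * C)
      (Eventually.of_forall fun z => ?_)
    have h1 := lfdr_mem_Icc hprob hf₀ hf₁ z
    simp only [Function.comp, Real.norm_eq_abs, abs_mul]
    refine mul_le_mul ?_ (hC z) (abs_nonneg _) (by positivity)
    refine (abs_sub _ _).trans (add_le_add le_rfl ?_)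
    rw [abs_le]; constructor <;> linarith [h1.1, h1.2]
  rw [twoGroupLaw, integral_add_measure ((hint 0 _).smul_measure ENNReal.ofReal_ne_top)
    ((hint 1 _).smul_measure ENNReal.ofReal_ne_top), integral_smul_measure, integral_smul_measure,
    Measure.dirac_prod, Measure.dirac_prod,
    integral_map (hmk 0).aemeasurable hF.aestronglyMeasurable,
    integral_map (hmk 1).aemeasurable hF.aestronglyMeasurable,
    hf₀.integral_withDensity, hf₁.integral_withDensity,
    ENNReal.toReal_ofReal (sub_nonneg.2 hprob.2), ENNReal.toReal_ofReal hprob.1,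
    smul_eq_mul, smul_eq_mul, ← integral_const_mul, ← integral_const_mul,
    add_eq_zero_iff_eq_neg, ← integral_neg]
  congr 1
  ext z
  -- The null component contributes `-(1 - lfdr)` and the alternative `lfdr`; with their weights
  -- they cancel pointwise.
  have := lfdr_balance hprob hf₀ hf₁ z
  linear_combination (-φ z) * this

lemma ae_twoGroupLaw (prob : ℝ) (f₀ f₁ : ℝ → ℝ) :
    ∀ᵐ y ∂(twoGroupLaw prob f₀ f₁), y.1 ∈ Set.Icc (0 : ℝ) 1 := by
  have hs : MeasurableSet {y : ℝ × ℝ | y.1 ∈ Set.Icc (0 : ℝ) 1} :=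
    measurable_fst measurableSet_Icc
  rw [twoGroupLaw, ae_add_measure_iff]
  constructor <;>
  · apply Measure.ae_smul_measure
    rw [Measure.dirac_prod, ae_map_iff measurable_prodMk_left.aemeasurable hs]
    simp

variable {Ω : Type*} [MeasurableSpace Ω] {P : Measure Ω} {θ Z : ℕ → Ω → ℝ}

lemma IsTwoGroupModel.ae_theta_mem (hM : IsTwoGroupModel P prob f₀ f₁ θ Z) :
    ∀ᵐ ω ∂P, ∀ i, θ i ω ∈ Set.Icc (0 : ℝ) 1 := by
  refine ae_all_iff.2 fun i => ?_
  have h := ae_twoGroupLaw prob f₀ f₁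
  rw [← hM.law i] at h
  exact ae_of_ae_map ((hM.measurable_theta i).prodMk (hM.measurable_Z i)).aemeasurable h

lemma IsTwoGroupModel.measurable_sample_Z (hM : IsTwoGroupModel P prob f₀ f₁ θ Z) (m : ℕ) :
    Measurable (sample Z m) :=
  measurable_pi_iff.2 fun i => hM.measurable_Z i

variable [IsProbabilityMeasure P]

/-- Fubini for the product law of the pair and `W`: for each fixed value of `W` the inner integral
vanishes by `integral_twoGroupLaw`. -/
lemma IsTwoGroupModel.integral_residual_mul_of_indepFun
    (hM : IsTwoGroupModel P prob f₀ f₁ θ Z)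
    (hprob : prob ∈ Set.Icc (0 : ℝ) 1) (hf₀ : IsDensity f₀) (hf₁ : IsDensity f₁)
    {E : Type*} [MeasurableSpace E] {W : Ω → E} (hW : Measurable W) (i : ℕ)
    (hind : IndepFun (fun ω => (θ i ω, Z i ω)) W P) {h : ℝ → E → ℝ}
    (hh : Measurable (Function.uncurry h)) (hb : ∀ w, ∃ C, ∀ z, |h z w| ≤ C)
    (hint : Integrable (fun ω => (θ i ω - (1 - lfdr prob f₀ f₁ (Z i ω))) * h (Z i ω) (W ω)) P) :
    ∫ ω, (θ i ω - (1 - lfdr prob f₀ f₁ (Z i ω))) * h (Z i ω) (W ω) ∂P = 0 := by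
  have hY : Measurable fun ω => (θ i ω, Z i ω) := (hM.measurable_theta i).prodMk (hM.measurable_Z i)
  have hl := measurable_lfdr (prob := prob) hf₀ hf₁
  let F : (ℝ × ℝ) × E → ℝ := fun x => (x.1.1 - (1 - lfdr prob f₀ f₁ x.1.2)) * h x.1.2 x.2
  have hF : Measurable F := by
    have h1 : Measurable fun x : (ℝ × ℝ) × E => h x.1.2 x.2 :=
      hh.comp (measurable_fst.snd.prodMk measurable_snd)
    exact (measurable_fst.fst.sub (measurable_const.sub (hl.comp measurable_fst.snd))).mul h1
  have hmap := (indepFun_iff_map_prod_eq_prod_map_map hY.aemeasurable hW.aemeasurable).1 hind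
  have hYW : Measurable fun ω => ((θ i ω, Z i ω), W ω) := hY.prodMk hW
  have hprobY : IsProbabilityMeasure (P.map fun ω => (θ i ω, Z i ω)) :=
    Measure.isProbabilityMeasure_map hY.aemeasurable
  have hprobW : IsProbabilityMeasure (P.map W) := Measure.isProbabilityMeasure_map hW.aemeasurable
  have hFint : Integrable F ((P.map fun ω => (θ i ω, Z i ω)).prod (P.map W)) := by
    rw [← hmap, integrable_map_measure hF.aestronglyMeasurable hYW.aemeasurable]
    exact hint
  have h1 : ∫ ω, (θ i ω - (1 - lfdr prob f₀ f₁ (Z i ω))) * h (Z i ω) (W ω) ∂P =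
      ∫ x, F x ∂((P.map fun ω => (θ i ω, Z i ω)).prod (P.map W)) := by
    rw [← hmap, integral_map hYW.aemeasurable hF.aestronglyMeasurable]
  rw [h1, integral_prod_symm _ hFint]
  refine integral_eq_zero_of_ae (Eventually.of_forall fun w => ?_)
  obtain ⟨C, hC⟩ := hb w
  rw [hM.law i]
  exact integral_twoGroupLaw hprob hf₀ hf₁ (hh.comp (measurable_id.prodMk measurable_const)) hC

/-- The residual `θ i - (1 - lfdr (Z i))` is orthogonal to every function of the data and of the
other `θ j`. -/
lemma IsTwoGroupModel.integral_residual_mul (hM : IsTwoGroupModel P prob f₀ f₁ θ Z)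
    (hprob : prob ∈ Set.Icc (0 : ℝ) 1) (hf₀ : IsDensity f₀) (hf₁ : IsDensity f₁)
    {m : ℕ} (i : Fin m) {G : (Fin m → ℝ) → (Fin m → ℝ) → ℝ}
    (hG : Measurable (Function.uncurry G)) (hb : ∀ t, ∃ C, ∀ z, |G t z| ≤ C)
    (hupd : ∀ t z a, G (Function.update t i a) z = G t z)
    (hint : Integrable (fun ω => (θ i ω - (1 - lfdr prob f₀ f₁ (Z i ω))) *
      G (sample θ m ω) (sample Z m ω)) P) :
    ∫ ω, (θ i ω - (1 - lfdr prob f₀ f₁ (Z i ω))) * G (sample θ m ω) (sample Z m ω) ∂P = 0 := by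
  have hYm (j : ℕ) : Measurable fun ω => (θ j ω, Z j ω) :=
    (hM.measurable_theta j).prodMk (hM.measurable_Z j)
  let S : Finset ℕ := (Finset.range m).erase i
  have hmem (j : Fin m) (hj : j ≠ i) : (j : ℕ) ∈ S :=
    Finset.mem_erase.2 ⟨fun h => hj (Fin.ext h), Finset.mem_range.2 j.2⟩
  let W : Ω → (S → ℝ × ℝ) := fun ω j => (θ j ω, Z j ω)
  have hW : Measurable W := measurable_pi_iff.2 fun j => hYm j
  have hind : IndepFun (fun ω => (θ i ω, Z i ω)) W P := by
    have h := hM.indep.indepFun_finset {(i : ℕ)} S (by simp [S]) hYm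
    exact h.comp (φ := fun x : (({(i : ℕ)} : Finset ℕ) → ℝ × ℝ) => x ⟨i, by simp⟩)
      (measurable_pi_apply _) measurable_id
  -- Both vectors are rebuilt from `Z i` and the other pairs; the missing `θ i` is replaced by `0`,
  -- which `G` does not notice by `hupd`.
  let h : ℝ → (S → ℝ × ℝ) → ℝ := fun z w =>
    G (fun j => if hj : j = i then 0 else (w ⟨j, hmem j hj⟩).1)
      (fun j => if hj : j = i then z else (w ⟨j, hmem j hj⟩).2)
  have hGh (ω : Ω) : G (sample θ m ω) (sample Z m ω) = h (Z i ω) (W ω) := by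
    rw [← hupd (sample θ m ω) (sample Z m ω) 0]
    simp only [h, W]
    congr 1 <;> ext j <;> by_cases hj : j = i <;> simp [hj, sample]
  simp only [hGh] at hint ⊢
  refine hM.integral_residual_mul_of_indepFun hprob hf₀ hf₁ hW i hind ?_ ?_ hint
  · have hw (s : S) : Measurable fun x : ℝ × (S → ℝ × ℝ) => x.2 s :=
      (measurable_pi_apply s).comp measurable_snd
    refine hG.comp (Measurable.prodMk (measurable_pi_iff.2 fun j => ?_)
      (measurable_pi_iff.2 fun j => ?_))
    · change Measurable fun x : ℝ × (S → ℝ × ℝ) =>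
        if hj : j = i then (0 : ℝ) else (x.2 ⟨j, hmem j hj⟩).1
      split_ifs with hj
      · exact measurable_const
      · exact (hw _).fst
    · change Measurable fun x : ℝ × (S → ℝ × ℝ) =>
        if hj : j = i then x.1 else (x.2 ⟨j, hmem j hj⟩).2
      split_ifs with hj
      · exact measurable_fst
      · exact (hw _).snd
  · intro w
    obtain ⟨C, hC⟩ := hb fun j => if hj : j = i then 0 else (w ⟨j, hmem j hj⟩).1
    exact ⟨C, fun z => hC _⟩

lemma abs_residual_le (hprob : prob ∈ Set.Icc (0 : ℝ) 1) (hf₀ : IsDensity f₀) (hf₁ : IsDensity f₁)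
    {t : ℝ} (ht : t ∈ Set.Icc (0 : ℝ) 1) (z : ℝ) : |t - (1 - lfdr prob f₀ f₁ z)| ≤ 1 := by
  have h := lfdr_mem_Icc hprob hf₀ hf₁ z
  rw [abs_le]
  constructor <;> linarith [h.1, h.2, ht.1, ht.2]

/-- Rejection probabilities given the data. -/
structure IsRule {m : ℕ} (δ : (Fin m → ℝ) → Fin m → ℝ) : Prop where
  measurable : ∀ i, Measurable fun z => δ z i
  mem_Icc : ∀ z i, δ z i ∈ Set.Icc (0 : ℝ) 1

lemma IsRule.abs_le {m : ℕ} {δ : (Fin m → ℝ) → Fin m → ℝ} (hδ : IsRule δ) (z : Fin m → ℝ)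
    (i : Fin m) : |δ z i| ≤ 1 := by
  rw [abs_of_nonneg (hδ.mem_Icc z i).1]
  exact (hδ.mem_Icc z i).2

variable {m : ℕ} {δ : (Fin m → ℝ) → Fin m → ℝ}

lemma IsTwoGroupModel.integrable_theta_mul (hM : IsTwoGroupModel P prob f₀ f₁ θ Z)
    (hδ : IsRule δ) (i : Fin m) :
    Integrable (fun ω => sample θ m ω i * δ (sample Z m ω) i) P := by
  refine Integrable.of_bound (C := 1) ?_ ?_
  · exact ((hM.measurable_theta i).mul
      ((hδ.measurable i).comp (hM.measurable_sample_Z m))).aestronglyMeasurable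
  · filter_upwards [hM.ae_theta_mem] with ω hω
    have h1 : |θ i ω| ≤ 1 := by rw [abs_of_nonneg (hω i).1]; exact (hω i).2
    rw [Real.norm_eq_abs, abs_mul]
    exact mul_le_one₀ h1 (abs_nonneg _) (hδ.abs_le _ _)

lemma IsTwoGroupModel.integrable_stat_mul (hM : IsTwoGroupModel P prob f₀ f₁ θ Z)
    (hprob : prob ∈ Set.Icc (0 : ℝ) 1) (hf₀ : IsDensity f₀) (hf₁ : IsDensity f₁)
    (hδ : IsRule δ) (i : Fin m) :
    Integrable (fun ω => (1 - oracleStat prob f₀ f₁ m (sample Z m ω) i) * δ (sample Z m ω) i) P := by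
  refine Integrable.of_bound (C := 1) ?_ (Eventually.of_forall fun ω => ?_)
  · exact ((measurable_const.sub ((measurable_lfdr hf₀ hf₁).comp (hM.measurable_Z i))).mul
      ((hδ.measurable i).comp (hM.measurable_sample_Z m))).aestronglyMeasurable
  · have h := lfdr_mem_Icc hprob hf₀ hf₁ (Z i ω)
    rw [Real.norm_eq_abs, abs_mul]
    refine mul_le_one₀ ?_ (abs_nonneg _) (hδ.abs_le _ _)
    change |1 - lfdr prob f₀ f₁ (Z i ω)| ≤ 1
    rw [_root_.abs_le]
    constructor <;> linarith [h.1, h.2]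

/-- A decision is a function of the data, hence orthogonal to the residual. -/
lemma IsTwoGroupModel.integral_theta_mul (hM : IsTwoGroupModel P prob f₀ f₁ θ Z)
    (hprob : prob ∈ Set.Icc (0 : ℝ) 1) (hf₀ : IsDensity f₀) (hf₁ : IsDensity f₁)
    (hδ : IsRule δ) (i : Fin m) :
    ∫ ω, sample θ m ω i * δ (sample Z m ω) i ∂P =
      ∫ ω, (1 - oracleStat prob f₀ f₁ m (sample Z m ω) i) * δ (sample Z m ω) i ∂P := by
  have h1 := hM.integrable_theta_mul hδ i
  have h2 := hM.integrable_stat_mul hprob hf₀ hf₁ hδ i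
  rw [← sub_eq_zero, ← integral_sub h1 h2]
  have h := hM.integral_residual_mul hprob hf₀ hf₁ i (G := fun _ z => δ z i)
    ((hδ.measurable i).comp measurable_snd) (fun _ => ⟨1, fun z => hδ.abs_le z i⟩)
    (fun _ _ _ => rfl) ((h1.sub h2).congr (Eventually.of_forall fun ω => by
      simp only [Pi.sub_apply, sample, oracleStat]; ring))
  rw [← h]
  congr 1
  ext ω
  simp only [sample, oracleStat]
  ring

lemma IsTwoGroupModel.etp_eq (hM : IsTwoGroupModel P prob f₀ f₁ θ Z)
    (hprob : prob ∈ Set.Icc (0 : ℝ) 1) (hf₀ : IsDensity f₀) (hf₁ : IsDensity f₁)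
    (hδ : IsRule δ) :
    etp P θ Z m δ =
      ∫ ω, ∑ i, (1 - oracleStat prob f₀ f₁ m (sample Z m ω) i) * δ (sample Z m ω) i ∂P := by
  unfold etp
  rw [integral_finsetSum _ fun i _ => hM.integrable_theta_mul hδ i,
    integral_finsetSum _ fun i _ => hM.integrable_stat_mul hprob hf₀ hf₁ hδ i]
  exact Finset.sum_congr rfl fun i _ => hM.integral_theta_mul hprob hf₀ hf₁ hδ i

lemma IsTwoGroupModel.regret_eq (hM : IsTwoGroupModel P prob f₀ f₁ θ Z)
    {δ' : (Fin m → ℝ) → Fin m → ℝ} (hδ : IsRule δ) (hδ' : IsRule δ') :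
    regret P θ Z m δ δ' = (m : ℝ)⁻¹ * (etp P θ Z m δ - etp P θ Z m δ') := by
  unfold regret etp
  rw [integral_sub (integrable_finsetSum _ fun i _ => hM.integrable_theta_mul hδ i)
    (integrable_finsetSum _ fun i _ => hM.integrable_theta_mul hδ' i)]

/-- The number of true positives deviates from its conditional mean given the data by `O(√m)`. -/
lemma IsTwoGroupModel.integral_sq_residual_le (hM : IsTwoGroupModel P prob f₀ f₁ θ Z)
    (hprob : prob ∈ Set.Icc (0 : ℝ) 1) (hf₀ : IsDensity f₀) (hf₁ : IsDensity f₁)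
    (hδ : IsRule δ) :
    Integrable (fun ω => (∑ i : Fin m, (θ i ω - (1 - lfdr prob f₀ f₁ (Z i ω))) *
      δ (sample Z m ω) i) ^ 2) P ∧
    ∫ ω, (∑ i : Fin m, (θ i ω - (1 - lfdr prob f₀ f₁ (Z i ω))) * δ (sample Z m ω) i) ^ 2 ∂P
      ≤ m := by
  have hl := measurable_lfdr (prob := prob) hf₀ hf₁
  let ξ : Fin m → Ω → ℝ := fun i ω => θ i ω - (1 - lfdr prob f₀ f₁ (Z i ω))
  have hξ (i : Fin m) : Measurable (ξ i) :=
    (hM.measurable_theta i).sub (measurable_const.sub (hl.comp (hM.measurable_Z i)))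
  have hd (i : Fin m) : Measurable fun ω => δ (sample Z m ω) i :=
    (hδ.measurable i).comp (hM.measurable_sample_Z m)
  let a : Fin m → Fin m → Ω → ℝ := fun i j ω =>
    (ξ i ω * δ (sample Z m ω) i) * (ξ j ω * δ (sample Z m ω) j)
  have ha1 (i j : Fin m) : ∀ᵐ ω ∂P, ‖a i j ω‖ ≤ 1 := by
    filter_upwards [hM.ae_theta_mem] with ω hω
    have hh (i : Fin m) : |ξ i ω * δ (sample Z m ω) i| ≤ 1 := by
      rw [abs_mul]
      exact mul_le_one₀ (abs_residual_le hprob hf₀ hf₁ (hω i) _) (abs_nonneg _) (hδ.abs_le _ _)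
    rw [Real.norm_eq_abs, abs_mul]
    exact mul_le_one₀ (hh i) (abs_nonneg _) (hh j)
  have haint (i j : Fin m) : Integrable (a i j) P :=
    Integrable.of_bound (((hξ i).mul (hd i)).mul ((hξ j).mul (hd j))).aestronglyMeasurable 1 (ha1 i j)
  -- Apart from the residual of `i`, the product involves only the data and `θ j`. Only the `m`
  -- diagonal terms survive, each at most `1`.
  have hoff (i j : Fin m) (hij : i ≠ j) : ∫ ω, a i j ω ∂P = 0 := by
    have heq (ω : Ω) : a i j ω = (θ i ω - (1 - lfdr prob f₀ f₁ (Z i ω))) *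
        ((sample θ m ω j - (1 - lfdr prob f₀ f₁ (sample Z m ω j))) *
          (δ (sample Z m ω) i * δ (sample Z m ω) j)) := by
      simp only [a, ξ, sample]; ring
    have hi := haint i j
    rw [show a i j = _ from funext heq] at hi
    simp only [heq]
    refine hM.integral_residual_mul hprob hf₀ hf₁ i
      (G := fun t z => (t j - (1 - lfdr prob f₀ f₁ (z j))) * (δ z i * δ z j)) ?_ ?_ ?_ hi
    · have h1 : Measurable fun x : (Fin m → ℝ) × (Fin m → ℝ) => x.1 j :=
        (measurable_pi_apply j).comp measurable_fst
      have h2 : Measurable fun x : (Fin m → ℝ) × (Fin m → ℝ) => lfdr prob f₀ f₁ (x.2 j) :=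
        hl.comp ((measurable_pi_apply j).comp measurable_snd)
      exact (h1.sub (measurable_const.sub h2)).mul (((hδ.measurable i).comp measurable_snd).mul
        ((hδ.measurable j).comp measurable_snd))
    · refine fun t => ⟨|t j| + 1, fun z => ?_⟩
      have h1 := lfdr_mem_Icc hprob hf₀ hf₁ (z j)
      rw [abs_mul, abs_mul]
      refine (mul_le_of_le_one_right (abs_nonneg _)
        (mul_le_one₀ (hδ.abs_le z i) (abs_nonneg _) (hδ.abs_le z j))).trans ?_
      refine (abs_sub _ _).trans (add_le_add le_rfl ?_)
      rw [_root_.abs_le]; constructor <;> linarith [h1.1, h1.2]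
    · intro t z b
      simp [Function.update_of_ne hij.symm]
  have hexp (ω : Ω) : (∑ i : Fin m, (θ i ω - (1 - lfdr prob f₀ f₁ (Z i ω))) *
      δ (sample Z m ω) i) ^ 2 = ∑ i, ∑ j, a i j ω := by
    rw [sq, Finset.sum_mul_sum]
  simp only [hexp]
  refine ⟨integrable_finsetSum _ fun i _ => integrable_finsetSum _ fun j _ => haint i j, ?_⟩
  rw [integral_finsetSum _ fun i _ => integrable_finsetSum _ fun j _ => haint i j]
  calc ∑ i, ∫ ω, ∑ j, a i j ω ∂P ≤ ∑ i : Fin m, (1 : ℝ) := by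
        refine Finset.sum_le_sum fun i _ => ?_
        rw [integral_finsetSum _ fun j _ => haint i j, Finset.sum_eq_single i
          (fun j _ hj => hoff i j hj.symm) (by simp)]
        have h := integral_mono_ae (haint i i) (integrable_const (1 : ℝ))
          ((ha1 i i).mono fun ω h => (le_abs_self _).trans h)
        simpa using h
    _ = m := by simp

end Model

/-! ### Deterministic stability of the step-up count. -/

section Stability

/-- The number of statistics below `x`. -/
noncomputable def countBelow {m : ℕ} (T : Fin m → ℝ) (x : ℝ) : ℕ :=
  (Finset.univ.filter fun i => T i < x).card

lemma countBelow_eq_sum {m : ℕ} (T : Fin m → ℝ) (x : ℝ) :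
    (countBelow T x : ℝ) = ∑ i, if T i < x then 1 else 0 := by
  simp [countBelow]

lemma measurable_countBelow {m : ℕ} (x : ℝ) :
    Measurable fun T : Fin m → ℝ => (countBelow T x : ℝ) := by
  simp only [countBelow_eq_sum]
  exact Finset.measurable_fun_sum _ fun i _ => Measurable.ite
    (measurableSet_lt (measurable_pi_apply i) measurable_const) measurable_const measurable_const

lemma countBelow_le {m : ℕ} (T : Fin m → ℝ) (x : ℝ) : countBelow T x ≤ m := by
  simpa [countBelow] using Finset.card_le_univ (Finset.univ.filter fun i => T i < x)

/-- The indices with `T i < γ - ρ` compete with the top set of their size, and each contributes at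
most `-ρ`. -/
lemma excess_countBelow_le {m : ℕ} (T : Fin m → ℝ) (γ ρ : ℝ) :
    excess T γ (countBelow T (γ - ρ)) ≤ -(ρ * countBelow T (γ - ρ)) := by
  refine (excess_le_sum T γ _).trans ?_
  calc _ ≤ ∑ i ∈ Finset.univ.filter (fun i => T i < γ - ρ), (-ρ) :=
        Finset.sum_le_sum fun i hi => by linarith [(Finset.mem_filter.1 hi).2]
    _ = _ := by rw [Finset.sum_const, nsmul_eq_mul, countBelow]; ring

/-- Deterministic stability of the step-up procedure: if a fraction `c` of the statistics is below
`γ - ρ` and the estimates are accurate on average, then the estimated number of rejections is close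
to the oracle one, it is of order `m`, and the estimated rejection set keeps within its budget. -/
lemma stepUp_stability {γ α ρ c τ : ℝ} (hγ : 0 ≤ γ) (hα : α ∈ Set.Ioo (0 : ℝ) 1) (hρ : 0 < ρ)
    (hc : 0 < c) (hτ : 0 < τ) (hτρ : 6 * τ ≤ ρ * c) {η : ℕ → ℝ} (hη : ∀ m, 0 ≤ η m)
    (hη0 : Tendsto η atTop (𝓝 0)) :
    ∀ᶠ m : ℕ in atTop, ∀ T T' : Fin m → ℝ, (∀ i, T i ∈ Set.Icc (0 : ℝ) 1) →
      (∀ i, T' i ∈ Set.Icc (0 : ℝ) 1) → c * m ≤ countBelow T (γ - ρ) →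
      ∑ i, |T i - T' i| ≤ τ * m →
      |(stepUpCount T γ α : ℝ) - stepUpCount T' γ (α + η m)| ≤ 12 * τ / (ρ * c) * m ∧
      c * m ≤ stepUpCount T' γ (α + η m) ∧
      ∑ i, (T i - γ) * topRule T' (stepUpCount T' γ (α + η m)) i ≤ 5 * τ * m := by
  -- With deviation scale `t = τ * m`, the Chebyshev bound `m / t ^ 2` vanishes.
  have hlim : Tendsto (fun m : ℕ => (m : ℝ) / (τ * m) ^ 2) atTop (𝓝 0) := by
    have h := (tendsto_inv_atTop_nhds_zero_nat (𝕜 := ℝ)).const_mul (1 / τ ^ 2)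
    rw [mul_zero] at h
    refine h.congr fun m => ?_
    rcases eq_or_ne (m : ℝ) 0 with hm | hm
    · simp [hm]
    · field_simp
  have e1 := hlim.eventually_le_const hα.1
  -- Half of the gap `1 - α` is kept for Chebyshev, the other half absorbs `η m`.
  have e2 := hlim.eventually_lt_const (show (0 : ℝ) < (1 - α) / 2 by linarith [hα.2])
  have e3 := hη0.eventually_le_const (show (0 : ℝ) < (1 - α) / 2 by linarith [hα.2])
  have e4 := (tendsto_natCast_atTop_atTop (R := ℝ)).eventually_ge_atTop (1 / τ)
  filter_upwards [e1, e2, e3, e4, eventually_gt_atTop 0] with m e1 e2 e3 e4 hm0 T T' hT hT' hN hD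
  have hm : (0 : ℝ) < m := by exact_mod_cast hm0
  have ht : 1 ≤ τ * m := by rw [div_le_iff₀ hτ] at e4; linarith
  have hk₀ := countBelow_le T (γ - ρ)
  have hex := excess_countBelow_le T γ ρ
  have hexm : excess T γ (countBelow T (γ - ρ)) ≤ -(ρ * c * m) := by nlinarith
  have hneg : excess T γ (countBelow T (γ - ρ)) < -(2 * (τ * m)) := by nlinarith
  have hη' := hη m
  have hD0 : ∑ i, |T i - T i| ≤ τ * m := by
    simp only [sub_self, abs_zero, Finset.sum_const_zero]; positivity
  have n1 := nearlyExhausts_stepUpCount (γ := γ) (β := α) hT hγ ht e1 (by linarith) hD0 hk₀ hneg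
  have n2 := nearlyExhausts_stepUpCount (γ := γ) (β := α + η m) hT' hγ ht (by linarith)
    (by linarith) hD hk₀ hneg
  refine ⟨?_, ?_, ?_⟩
  -- The dip `-(ρ * c * m)` is `-(2 * s * m)`, and `6 * τ ≤ ρ * c` says that `u = 3 * τ * m` is at
  -- most `s * m`.
  · refine (n1.abs_sub_le n2 (s := ρ * c / 2) (by positivity) (by linarith) (by positivity)
      (by nlinarith)).trans (le_of_eq ?_)
    field_simp
    ring
  · exact hN.trans (by exact_mod_cast n2.ge)
  · rw [sum_mul_topRule]
    -- The excess of `T` is at most `3 * τ * m`; passing to `T'` and back to `T` on the estimated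
    -- set adds two total errors, giving `5 * τ * m`.
    have h1 := excess_le_excess_add T' T γ n2.le
    rw [dist_comm_sum] at h1
    have h2 : ∑ i ∈ topSet T' (stepUpCount T' γ (α + η m)), (T i - γ) ≤
        excess T' γ (stepUpCount T' γ (α + η m)) + ∑ i, |T i - T' i| := by
      have := sum_le_sum_add_dist (fun i => T i - γ) (fun i => T' i - γ)
        (topSet T' (stepUpCount T' γ (α + η m)))
      simpa [excess] using this
    linarith [n2.excess_le]

end Stability

/-! ### Regret bounds, estimation error and the law of large numbers. -/

section Asymptotics

variable {Ω : Type*} [MeasurableSpace Ω] {P : Measure Ω} [IsProbabilityMeasure P]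
  {prob : ℝ} {f₀ f₁ : ℝ → ℝ} {θ Z : ℕ → Ω → ℝ} {That : (m : ℕ) → (Fin m → ℝ) → Fin m → ℝ}

lemma isRule_topRule {m : ℕ} {T : (Fin m → ℝ) → Fin m → ℝ} (hT : Measurable T)
    {k : (Fin m → ℝ) → ℕ} (hk : Measurable k) : IsRule fun z => topRule (T z) (k z) :=
  ⟨fun i => measurable_topRule hT hk i, fun _ i => topRule_mem_Icc _ _ i⟩

lemma isRule_stepUpRule {m : ℕ} {T : (Fin m → ℝ) → Fin m → ℝ} (hT : Measurable T) (γ β : ℝ) :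
    IsRule fun z => stepUpRule (T z) γ β :=
  isRule_topRule hT ((measurable_stepUpCount γ β).comp hT)

lemma isRule_randomizedRule {m : ℕ} {T : (Fin m → ℝ) → Fin m → ℝ} (hT : Measurable T) (γ : ℝ)
    {α : ℝ} (hα : 0 ≤ α) : IsRule fun z => randomizedRule (T z) γ α :=
  ⟨fun i => (measurable_randomizedRule γ α i).comp hT,
    fun _ i => randomizedRule_mem_Icc _ γ hα i⟩

lemma IsTwoGroupModel.abs_regret_le (hM : IsTwoGroupModel P prob f₀ f₁ θ Z)
    (hprob : prob ∈ Set.Icc (0 : ℝ) 1) (hf₀ : IsDensity f₀) (hf₁ : IsDensity f₁)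
    {m : ℕ} {δ δ' : (Fin m → ℝ) → Fin m → ℝ} (hδ : IsRule δ) (hδ' : IsRule δ')
    {B : Ω → ℝ} (hB : Integrable B P)
    (h : ∀ ω, |∑ i, (1 - oracleStat prob f₀ f₁ m (sample Z m ω) i) * δ (sample Z m ω) i -
      ∑ i, (1 - oracleStat prob f₀ f₁ m (sample Z m ω) i) * δ' (sample Z m ω) i| ≤ B ω) :
    |regret P θ Z m δ δ'| ≤ (m : ℝ)⁻¹ * ∫ ω, B ω ∂P := by
  rw [hM.regret_eq hδ hδ', hM.etp_eq hprob hf₀ hf₁ hδ, hM.etp_eq hprob hf₀ hf₁ hδ',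
    ← integral_sub (integrable_finsetSum _ fun i _ => hM.integrable_stat_mul hprob hf₀ hf₁ hδ i)
      (integrable_finsetSum _ fun i _ => hM.integrable_stat_mul hprob hf₀ hf₁ hδ' i),
    abs_mul, abs_of_nonneg (by positivity : (0 : ℝ) ≤ (m : ℝ)⁻¹)]
  refine mul_le_mul_of_nonneg_left ?_ (by positivity)
  rw [← Real.norm_eq_abs]
  refine norm_integral_le_of_norm_le hB (Eventually.of_forall fun ω => ?_)
  rw [Real.norm_eq_abs]
  exact h ω

/-- Total estimation error of the statistics. -/
noncomputable def totalError (prob : ℝ) (f₀ f₁ : ℝ → ℝ)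
    (That : (m : ℕ) → (Fin m → ℝ) → Fin m → ℝ) (m : ℕ) (z : Fin m → ℝ) : ℝ :=
  ∑ i, |oracleStat prob f₀ f₁ m z i - That m z i|

lemma measurable_totalError (hf₀ : IsDensity f₀) (hf₁ : IsDensity f₁)
    (hThat : IsLfdrEstimator That) (m : ℕ) : Measurable (totalError prob f₀ f₁ That m) :=
  Finset.measurable_fun_sum _ fun i _ =>
    (((measurable_pi_apply i).comp (measurable_oracleStat hf₀ hf₁ m)).sub
      ((measurable_pi_apply i).comp (hThat.measurable m))).abs

lemma oracleStat_mem_Icc (hprob : prob ∈ Set.Icc (0 : ℝ) 1) (hf₀ : IsDensity f₀)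
    (hf₁ : IsDensity f₁) {m : ℕ} (z : Fin m → ℝ) (i : Fin m) :
    oracleStat prob f₀ f₁ m z i ∈ Set.Icc (0 : ℝ) 1 :=
  lfdr_mem_Icc hprob hf₀ hf₁ _

lemma abs_oracleStat_sub_le_one (hprob : prob ∈ Set.Icc (0 : ℝ) 1) (hf₀ : IsDensity f₀)
    (hf₁ : IsDensity f₁) (hThat : IsLfdrEstimator That) {m : ℕ} (z : Fin m → ℝ) (i : Fin m) :
    |oracleStat prob f₀ f₁ m z i - That m z i| ≤ 1 := by
  have h1 := oracleStat_mem_Icc hprob hf₀ hf₁ z i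
  have h2 := hThat.mem_Icc m z i
  rw [abs_le]
  constructor <;> linarith [h1.1, h1.2, h2.1, h2.2]

lemma totalError_nonneg {m : ℕ} (z : Fin m → ℝ) : 0 ≤ totalError prob f₀ f₁ That m z :=
  Finset.sum_nonneg fun _ _ => abs_nonneg _

lemma IsTwoGroupModel.integrable_abs_error (hM : IsTwoGroupModel P prob f₀ f₁ θ Z)
    (hprob : prob ∈ Set.Icc (0 : ℝ) 1) (hf₀ : IsDensity f₀) (hf₁ : IsDensity f₁)
    (hThat : IsLfdrEstimator That) {m : ℕ} (i : Fin m) :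
    Integrable (fun ω => |oracleStat prob f₀ f₁ m (sample Z m ω) i - That m (sample Z m ω) i|) P := by
  refine Integrable.of_bound (C := 1) ?_ (Eventually.of_forall fun ω => ?_)
  · exact ((((measurable_pi_apply i).comp (measurable_oracleStat hf₀ hf₁ m)).sub
      ((measurable_pi_apply i).comp (hThat.measurable m))).abs.comp
        (hM.measurable_sample_Z m)).aestronglyMeasurable
  · rw [Real.norm_eq_abs, abs_abs]
    exact abs_oracleStat_sub_le_one hprob hf₀ hf₁ hThat _ _

lemma IsTwoGroupModel.integrable_totalError (hM : IsTwoGroupModel P prob f₀ f₁ θ Z)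
    (hprob : prob ∈ Set.Icc (0 : ℝ) 1) (hf₀ : IsDensity f₀) (hf₁ : IsDensity f₁)
    (hThat : IsLfdrEstimator That) (m : ℕ) :
    Integrable (fun ω => totalError prob f₀ f₁ That m (sample Z m ω)) P :=
  integrable_finsetSum _ fun i _ => hM.integrable_abs_error hprob hf₀ hf₁ hThat i

/-- Consistency makes the average estimation error vanish in mean. -/
lemma IsTwoGroupModel.tendsto_mean_totalError (hM : IsTwoGroupModel P prob f₀ f₁ θ Z)
    (hprob : prob ∈ Set.Icc (0 : ℝ) 1) (hf₀ : IsDensity f₀) (hf₁ : IsDensity f₁)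
    (hThat : IsLfdrEstimator That) (hcons : IsConsistent P Z prob f₀ f₁ That) :
    Tendsto (fun m : ℕ => (m : ℝ)⁻¹ * ∫ ω, totalError prob f₀ f₁ That m (sample Z m ω) ∂P)
      atTop (𝓝 0) := by
  rw [Metric.tendsto_nhds]
  intro ε hε
  filter_upwards [hcons (ε / 3) (by positivity) (ε / 3) (by positivity), eventually_gt_atTop 0]
    with m hm hm0
  have hmpos : (0 : ℝ) < m := by exact_mod_cast hm0
  have hterm (i : Fin m) :
      ∫ ω, |oracleStat prob f₀ f₁ m (sample Z m ω) i - That m (sample Z m ω) i| ∂P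
        ≤ ε / 3 + ε / 3 := by
    set X : Ω → ℝ := fun ω => oracleStat prob f₀ f₁ m (sample Z m ω) i - That m (sample Z m ω) i
    have hX : Measurable X := (((measurable_pi_apply i).comp (measurable_oracleStat hf₀ hf₁ m)).sub
      ((measurable_pi_apply i).comp (hThat.measurable m))).comp (hM.measurable_sample_Z m)
    have hS : MeasurableSet {ω | ε / 3 ≤ |X ω|} := measurableSet_le measurable_const hX.abs
    have hind : Integrable ({ω | ε / 3 ≤ |X ω|}.indicator fun _ => (1 : ℝ)) P :=
      (integrable_const _).indicator hS
    -- Since `|X| ≤ 1`, its mean is at most `ε / 3` plus the probability that it reaches `ε / 3`.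
    calc ∫ ω, |X ω| ∂P
        ≤ ∫ ω, (ε / 3 + {ω | ε / 3 ≤ |X ω|}.indicator (fun _ => (1 : ℝ)) ω) ∂P := by
          refine integral_mono (hM.integrable_abs_error hprob hf₀ hf₁ hThat i)
            ((integrable_const _).add hind) fun ω => ?_
          by_cases hω : ε / 3 ≤ |X ω|
          · have h1 : |X ω| ≤ 1 := abs_oracleStat_sub_le_one hprob hf₀ hf₁ hThat _ _
            simp only [Set.indicator, Set.mem_ofPred_eq, hω, if_true]
            linarith
          · simp only [Set.indicator, Set.mem_ofPred_eq, hω, if_false]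
            linarith
      _ = ε / 3 + P.real {ω | ε / 3 ≤ |X ω|} := by
          rw [integral_add (integrable_const _) hind, integral_indicator_const _ hS]
          simp
      _ ≤ ε / 3 + ε / 3 := by linarith [hm i]
  have hsum : ∫ ω, totalError prob f₀ f₁ That m (sample Z m ω) ∂P ≤ m * (ε / 3 + ε / 3) := by
    unfold totalError
    rw [integral_finsetSum _ fun i _ => hM.integrable_abs_error hprob hf₀ hf₁ hThat i]
    refine (Finset.sum_le_sum fun i _ => hterm i).trans (le_of_eq ?_)
    simp [mul_add]
  have hnn : 0 ≤ ∫ ω, totalError prob f₀ f₁ That m (sample Z m ω) ∂P :=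
    integral_nonneg fun ω => totalError_nonneg _
  rw [Real.dist_eq, sub_zero, abs_of_nonneg (by positivity), inv_mul_lt_iff₀ hmpos]
  nlinarith

/-- Top-`k` selection by consistent estimates has vanishing scaled regret. -/
lemma IsTwoGroupModel.tendsto_regret_topRule (hM : IsTwoGroupModel P prob f₀ f₁ θ Z)
    (hprob : prob ∈ Set.Icc (0 : ℝ) 1) (hf₀ : IsDensity f₀) (hf₁ : IsDensity f₁)
    (hThat : IsLfdrEstimator That) (hcons : IsConsistent P Z prob f₀ f₁ That)
    {k : (m : ℕ) → (Fin m → ℝ) → ℕ} (hk : ∀ m, Measurable (k m)) :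
    Tendsto (fun m => regret P θ Z m
      (fun z => topRule (oracleStat prob f₀ f₁ m z) (k m z))
      (fun z => topRule (That m z) (k m z))) atTop (𝓝 0) := by
  have h := (hM.tendsto_mean_totalError hprob hf₀ hf₁ hThat hcons).const_mul 2
  rw [mul_zero] at h
  refine squeeze_zero_norm (fun m => ?_) h
  refine (hM.abs_regret_le hprob hf₀ hf₁
    (isRule_topRule (measurable_oracleStat hf₀ hf₁ m) (hk m))
    (isRule_topRule (hThat.measurable m) (hk m))
    ((hM.integrable_totalError hprob hf₀ hf₁ hThat m).const_mul 2)
    fun ω => abs_sum_topRule_sub_le _ _ _).trans (le_of_eq ?_)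
  rw [integral_const_mul]
  ring

lemma IsTwoGroupModel.tendsto_measure_totalError (hM : IsTwoGroupModel P prob f₀ f₁ θ Z)
    (hprob : prob ∈ Set.Icc (0 : ℝ) 1) (hf₀ : IsDensity f₀) (hf₁ : IsDensity f₁)
    (hThat : IsLfdrEstimator That) (hcons : IsConsistent P Z prob f₀ f₁ That) {τ : ℝ}
    (hτ : 0 < τ) :
    Tendsto (fun m : ℕ => P.real {ω | τ * m < totalError prob f₀ f₁ That m (sample Z m ω)})
      atTop (𝓝 0) := by
  have h := (hM.tendsto_mean_totalError hprob hf₀ hf₁ hThat hcons).const_mul τ⁻¹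
  rw [mul_zero] at h
  refine squeeze_zero' (Eventually.of_forall fun _ => measureReal_nonneg) ?_ h
  filter_upwards [eventually_gt_atTop 0] with m hm0
  have hm : (0 : ℝ) < m := by exact_mod_cast hm0
  have hmarkov := mul_meas_ge_le_integral_of_nonneg
    (Eventually.of_forall fun ω => totalError_nonneg (sample Z m ω))
    (hM.integrable_totalError hprob hf₀ hf₁ hThat m) (τ * m)
  have hsub : P.real {ω | τ * m < totalError prob f₀ f₁ That m (sample Z m ω)} ≤
      P.real {ω | τ * m ≤ totalError prob f₀ f₁ That m (sample Z m ω)} :=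
    measureReal_mono fun ω hω => by
      simp only [Set.mem_ofPred_eq] at hω ⊢
      exact hω.le
  rw [← mul_assoc, ← mul_inv, inv_mul_eq_div, le_div_iff₀ (by positivity)]
  nlinarith [mul_pos hτ hm]

/-- If the lfdr falls below `γ` with positive probability, then with probability tending to one a
fixed fraction of the statistics is bounded away from `γ`. -/
lemma IsTwoGroupModel.exists_tendsto_countBelow (hM : IsTwoGroupModel P prob f₀ f₁ θ Z)
    (hf₀ : IsDensity f₀) (hf₁ : IsDensity f₁) {γ : ℝ}
    (hpos : 0 < P {ω | lfdr prob f₀ f₁ (Z 0 ω) < γ}) :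
    ∃ ρ > 0, ∃ c > 0, Tendsto (fun m : ℕ => P.real {ω |
      (countBelow (oracleStat prob f₀ f₁ m (sample Z m ω)) (γ - ρ) : ℝ) < c * m})
      atTop (𝓝 0) := by
  have hl := measurable_lfdr (prob := prob) hf₀ hf₁
  -- The event that the lfdr is below `γ` is a countable union of these events, so one of them has
  -- positive probability.
  obtain ⟨n, hn⟩ : ∃ n : ℕ, 0 < P {ω | lfdr prob f₀ f₁ (Z 0 ω) < γ - 1 / ((n : ℝ) + 1)} := by
    by_contra! hcon
    refine hpos.ne' (measure_mono_null (fun ω hω => ?_)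
      (measure_iUnion_null fun n => le_antisymm (hcon n) bot_le))
    have hω' : 0 < γ - lfdr prob f₀ f₁ (Z 0 ω) := sub_pos.2 hω
    obtain ⟨n, hn⟩ := exists_nat_one_div_lt hω'
    exact Set.mem_iUnion.2 ⟨n, by simp only [Set.mem_ofPred_eq]; linarith⟩
  set ρ : ℝ := 1 / ((n : ℝ) + 1)
  have hρ : 0 < ρ := Nat.one_div_pos_of_nat
  let g : ℝ × ℝ → ℝ := fun y => if lfdr prob f₀ f₁ y.2 < γ - ρ then 1 else 0
  have hg : Measurable g := Measurable.ite
    (measurableSet_lt (hl.comp measurable_snd) measurable_const) measurable_const measurable_const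
  have hYm (j : ℕ) : Measurable fun ω => (θ j ω, Z j ω) :=
    (hM.measurable_theta j).prodMk (hM.measurable_Z j)
  let X : ℕ → Ω → ℝ := fun j ω => g (θ j ω, Z j ω)
  have hX (j : ℕ) : Measurable (X j) := hg.comp (hYm j)
  have hXint : Integrable (X 0) P := by
    refine Integrable.of_bound (hX 0).aestronglyMeasurable 1 (Eventually.of_forall fun ω => ?_)
    simp only [X, g]
    split_ifs <;> simp
  have hset : MeasurableSet {ω | lfdr prob f₀ f₁ (Z 0 ω) < γ - ρ} :=
    measurableSet_lt (hl.comp (hM.measurable_Z 0)) measurable_const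
  have hmean : ∫ ω, X 0 ω ∂P = P.real {ω | lfdr prob f₀ f₁ (Z 0 ω) < γ - ρ} := by
    rw [← integral_indicator_one hset]
    rfl
  have hp : 0 < P.real {ω | lfdr prob f₀ f₁ (Z 0 ω) < γ - ρ} :=
    ENNReal.toReal_pos hn.ne' (measure_ne_top _ _)
  set p := P.real {ω | lfdr prob f₀ f₁ (Z 0 ω) < γ - ρ}
  have hlln := strong_law_ae_real X hXint
    (fun i j hij => (hM.indep.indepFun hij).comp hg hg)
    (fun i => IdentDistrib.comp (u := g)
      ⟨(hYm i).aemeasurable, (hYm 0).aemeasurable, by rw [hM.law i, hM.law 0]⟩ hg)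
  rw [hmean] at hlln
  have hmeas := tendstoInMeasure_of_tendsto_ae (μ := P) (g := fun _ => p) (fun m =>
    ((Finset.measurable_fun_sum (Finset.range m) fun i _ => hX i).div_const
      (m : ℝ)).aestronglyMeasurable) hlln
  rw [tendstoInMeasure_iff_norm] at hmeas
  have h2 := (ENNReal.tendsto_toReal ENNReal.zero_ne_top).comp (hmeas (p / 2) (by positivity))
  -- The empirical fraction tends to `p`, so falling below `p / 2` is a deviation of at least `p /
  -- 2`.
  refine ⟨ρ, hρ, p / 2, by positivity, squeeze_zero (fun _ => measureReal_nonneg)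
    (fun m => ?_) h2⟩
  refine measureReal_mono fun ω hω => ?_
  have hcount : (countBelow (oracleStat prob f₀ f₁ m (sample Z m ω)) (γ - ρ) : ℝ) =
      ∑ i ∈ Finset.range m, X i ω := by
    rw [Finset.sum_range, countBelow_eq_sum]
    rfl
  simp only [Set.mem_ofPred_eq] at hω ⊢
  rw [hcount] at hω
  have hm : (0 : ℝ) < m := by
    by_contra! hm
    have hm' : m = 0 := by exact_mod_cast le_antisymm hm (Nat.cast_nonneg m)
    subst hm'
    simp at hω
  rw [← div_lt_iff₀ hm] at hω
  rw [Real.norm_eq_abs, abs_sub_comm]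
  exact le_trans (by linarith) (le_abs_self _)

end Asymptotics

/-! ### The relaxed procedure: regret, power and validity. -/

section Relaxed

variable {Ω : Type*} [MeasurableSpace Ω] {P : Measure Ω} [IsProbabilityMeasure P]
  {prob : ℝ} {f₀ f₁ : ℝ → ℝ} {θ Z : ℕ → Ω → ℝ} {That : (m : ℕ) → (Fin m → ℝ) → Fin m → ℝ}
  {γ α : ℝ} {η : ℕ → ℝ}

lemma relaxedRule_eq {m : ℕ} (hThat : IsLfdrEstimator That) (hγ : 0 < γ) (hα : 0 ≤ α)
    (hη : ∀ m, 0 ≤ η m) (z : Fin m → ℝ) :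
    relaxedRule (That m z) γ α (η m) =
      topRule (That m z) (stepUpCount (That m z) γ (α + η m)) := by
  rw [relaxedRule, relaxedCount_eq (hThat.mem_Icc m z) hγ (add_nonneg hα (hη m))]

lemma isRule_relaxedRule (hThat : IsLfdrEstimator That) (hγ : 0 < γ) (hα : 0 ≤ α)
    (hη : ∀ m, 0 ≤ η m) (m : ℕ) : IsRule fun z => relaxedRule (That m z) γ α (η m) := by
  simp only [relaxedRule_eq hThat hγ hα hη]
  exact isRule_stepUpRule (hThat.measurable m) γ _

/-- With probability tending to one, the number of rejections of the relaxed procedure is close to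
that of the oracle, it is of order `m`, and the average of the true statistics over the rejection
set is close to at most `γ`. -/
lemma IsTwoGroupModel.exists_goodEvents (hM : IsTwoGroupModel P prob f₀ f₁ θ Z)
    (hprob : prob ∈ Set.Icc (0 : ℝ) 1) (hf₀ : IsDensity f₀) (hf₁ : IsDensity f₁)
    (hThat : IsLfdrEstimator That) (hcons : IsConsistent P Z prob f₀ f₁ That)
    (hγ : γ ∈ Set.Ioo (0 : ℝ) 1) (hα : α ∈ Set.Ioo (0 : ℝ) 1)
    (hpos : 0 < P {ω | lfdr prob f₀ f₁ (Z 0 ω) < γ}) (hη : ∀ m, 0 ≤ η m)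
    (hη0 : Tendsto η atTop (𝓝 0)) :
    ∃ c > 0, ∀ τ > 0, ∃ bad : ℕ → Set Ω, (∀ m, MeasurableSet (bad m)) ∧
      Tendsto (fun m => P.real (bad m)) atTop (𝓝 0) ∧
      ∀ᶠ m : ℕ in atTop, ∀ ω ∉ bad m,
        |∑ i, (1 - oracleStat prob f₀ f₁ m (sample Z m ω) i) *
            stepUpRule (oracleStat prob f₀ f₁ m (sample Z m ω)) γ α i -
          ∑ i, (1 - oracleStat prob f₀ f₁ m (sample Z m ω) i) *
            relaxedRule (That m (sample Z m ω)) γ α (η m) i| ≤ τ * m ∧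
        c * m ≤ ∑ i, relaxedRule (That m (sample Z m ω)) γ α (η m) i ∧
        ∑ i, (oracleStat prob f₀ f₁ m (sample Z m ω) i - γ) *
            relaxedRule (That m (sample Z m ω)) γ α (η m) i ≤ τ * m := by
  obtain ⟨ρ, hρ, c, hc, hcount⟩ := hM.exists_tendsto_countBelow hf₀ hf₁ hpos
  refine ⟨c, hc, fun τ hτ => ?_⟩
  -- `σ` bounds the average estimation error. The conditions on it serve, in order, the stability
  -- lemma, the count discrepancy plus re-ranking cost, and the excess.
  obtain ⟨σ, hσ, hσρ, hσ1, hσ2⟩ : ∃ σ > 0, 6 * σ ≤ ρ * c ∧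
      12 * σ / (ρ * c) + 2 * σ ≤ τ ∧ 5 * σ ≤ τ := by
    have hD : 0 < 12 / (ρ * c) + 2 := by positivity
    refine ⟨min (ρ * c / 6) (min (τ / (12 / (ρ * c) + 2)) (τ / 5)), by positivity, ?_, ?_, ?_⟩
    · linarith [min_le_left (ρ * c / 6) (min (τ / (12 / (ρ * c) + 2)) (τ / 5))]
    · have h : min (ρ * c / 6) (min (τ / (12 / (ρ * c) + 2)) (τ / 5)) ≤ τ / (12 / (ρ * c) + 2) :=
        (min_le_right _ _).trans (min_le_left _ _)
      rw [le_div_iff₀ hD] at h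
      calc _ = min (ρ * c / 6) (min (τ / (12 / (ρ * c) + 2)) (τ / 5)) * (12 / (ρ * c) + 2) := by
            ring
        _ ≤ τ := h
    · have h : min (ρ * c / 6) (min (τ / (12 / (ρ * c) + 2)) (τ / 5)) ≤ τ / 5 :=
        (min_le_right _ _).trans (min_le_right _ _)
      linarith
  have hZ := hM.measurable_sample_Z
  refine ⟨fun m => {ω | σ * m < totalError prob f₀ f₁ That m (sample Z m ω)} ∪
    {ω | (countBelow (oracleStat prob f₀ f₁ m (sample Z m ω)) (γ - ρ) : ℝ) < c * m},
    fun m => ?_, ?_, ?_⟩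
  · exact (measurableSet_lt measurable_const
      ((measurable_totalError hf₀ hf₁ hThat m).comp (hZ m))).union
      (measurableSet_lt ((measurable_countBelow (γ - ρ)).comp
        ((measurable_oracleStat hf₀ hf₁ m).comp (hZ m))) measurable_const)
  · have h := (hM.tendsto_measure_totalError hprob hf₀ hf₁ hThat hcons hσ).add hcount
    rw [add_zero] at h
    exact squeeze_zero (fun _ => measureReal_nonneg) (fun m => measureReal_union_le _ _) h
  filter_upwards [stepUp_stability hγ.1.le hα hρ hc hσ hσρ hη hη0] with m hm ω hω
  simp only [Set.mem_union, Set.mem_ofPred_eq, not_or, not_lt] at hω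
  rw [relaxedRule_eq hThat hγ.1 hα.1.le hη, stepUpRule]
  set T := oracleStat prob f₀ f₁ m (sample Z m ω)
  set T' := That m (sample Z m ω)
  have hT : ∀ i, T i ∈ Set.Icc (0 : ℝ) 1 := fun i => oracleStat_mem_Icc hprob hf₀ hf₁ _ i
  obtain ⟨h1, h2, h3⟩ := hm T T' hT (hThat.mem_Icc m _) hω.2 hω.1
  have hm0 : (0 : ℝ) ≤ m := Nat.cast_nonneg m
  refine ⟨?_, ?_, h3.trans (by gcongr)⟩
  · have h4 := abs_sum_topRule_sub_topRule_le hT (stepUpCount_le T γ α)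
      (stepUpCount_le T' γ (α + η m))
    have h5 := abs_sum_topRule_sub_le T T' (stepUpCount T' γ (α + η m))
    have h6 : ∑ i, |T i - T' i| ≤ σ * m := hω.1
    -- The intermediate rule combines the oracle ranking with the estimated count.
    refine (abs_sub_le _ (∑ i, (1 - T i) * topRule T (stepUpCount T' γ (α + η m)) i) _).trans ?_
    nlinarith
  · rw [sum_topRule _ (stepUpCount_le _ _ _)]
    exact h2

lemma abs_sum_sub_le_card {m : ℕ} {T δ δ' : Fin m → ℝ} (hT : ∀ i, T i ∈ Set.Icc (0 : ℝ) 1)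
    (hδ : ∀ i, δ i ∈ Set.Icc (0 : ℝ) 1) (hδ' : ∀ i, δ' i ∈ Set.Icc (0 : ℝ) 1) :
    |∑ i, (1 - T i) * δ i - ∑ i, (1 - T i) * δ' i| ≤ m := by
  rw [← Finset.sum_sub_distrib]
  refine (Finset.abs_sum_le_sum_abs _ _).trans ?_
  calc _ ≤ ∑ i : Fin m, (1 : ℝ) := Finset.sum_le_sum fun i _ => by
        have h1 := hT i
        have h2 := hδ i
        have h3 := hδ' i
        rw [← mul_sub, abs_mul]
        refine mul_le_one₀ ?_ (abs_nonneg _) ?_ <;> rw [abs_le] <;>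
          constructor <;> linarith [h1.1, h1.2, h2.1, h2.2, h3.1, h3.2]
    _ = m := by simp

/-- The relaxed data-driven procedure has vanishing scaled regret against the oracle. -/
lemma IsTwoGroupModel.tendsto_regret_stepUpRule (hM : IsTwoGroupModel P prob f₀ f₁ θ Z)
    (hprob : prob ∈ Set.Icc (0 : ℝ) 1) (hf₀ : IsDensity f₀) (hf₁ : IsDensity f₁)
    (hThat : IsLfdrEstimator That) (hcons : IsConsistent P Z prob f₀ f₁ That)
    (hγ : γ ∈ Set.Ioo (0 : ℝ) 1) (hα : α ∈ Set.Ioo (0 : ℝ) 1)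
    (hpos : 0 < P {ω | lfdr prob f₀ f₁ (Z 0 ω) < γ}) (hη : ∀ m, 0 ≤ η m)
    (hη0 : Tendsto η atTop (𝓝 0)) :
    Tendsto (fun m => regret P θ Z m (fun z => stepUpRule (oracleStat prob f₀ f₁ m z) γ α)
      (fun z => relaxedRule (That m z) γ α (η m))) atTop (𝓝 0) := by
  obtain ⟨c, hc, hgood⟩ :=
    hM.exists_goodEvents hprob hf₀ hf₁ hThat hcons hγ hα hpos hη hη0
  rw [Metric.tendsto_nhds]
  intro ε hε
  obtain ⟨bad, hbadm, hbad0, hev⟩ := hgood (ε / 3) (by positivity)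
  filter_upwards [hev, hbad0.eventually_le_const (show 0 < ε / 3 by positivity),
    eventually_gt_atTop 0] with m hm hb hm0
  have hmpos : (0 : ℝ) < m := by exact_mod_cast hm0
  have hor : IsRule fun z => stepUpRule (oracleStat prob f₀ f₁ m z) γ α :=
    isRule_stepUpRule (measurable_oracleStat hf₀ hf₁ m) γ α
  have hrel := isRule_relaxedRule (γ := γ) (α := α) hThat hγ.1 hα.1.le hη m
  have hind : Integrable ((bad m).indicator fun _ => (m : ℝ)) P :=
    (integrable_const _).indicator (hbadm m)
  -- The difference is at most `ε / 3 * m` off the bad event and `m` on it, and that event has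
  -- probability at most `ε / 3`.
  have h := hM.abs_regret_le hprob hf₀ hf₁ hor hrel
    ((integrable_const (ε / 3 * m)).add hind) fun ω => ?_
  · rw [Real.dist_eq, sub_zero]
    refine h.trans_lt ?_
    simp only [Pi.add_apply]
    rw [integral_add (integrable_const _) hind, integral_indicator_const _ (hbadm m),
      inv_mul_lt_iff₀ hmpos]
    simp only [integral_const, probReal_univ, smul_eq_mul]
    nlinarith
  · simp only [Pi.add_apply]
    by_cases hω : ω ∈ bad m
    · have := abs_sum_sub_le_card (oracleStat_mem_Icc hprob hf₀ hf₁ (sample Z m ω))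
        (hor.mem_Icc (sample Z m ω)) (hrel.mem_Icc (sample Z m ω))
      rw [Set.indicator_of_mem hω]
      exact this.trans (le_add_of_nonneg_left (by positivity))
    · rw [Set.indicator_of_notMem hω, add_zero]
      exact (hm ω hω).1

/-- Randomization changes the scaled regret by a vanishing amount. -/
lemma IsTwoGroupModel.tendsto_regret_randomizedRule (hM : IsTwoGroupModel P prob f₀ f₁ θ Z)
    (hprob : prob ∈ Set.Icc (0 : ℝ) 1) (hf₀ : IsDensity f₀) (hf₁ : IsDensity f₁)
    (hα : 0 ≤ α) {δ : (m : ℕ) → (Fin m → ℝ) → Fin m → ℝ} (hδ : ∀ m, IsRule (δ m))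
    (h : Tendsto (fun m => regret P θ Z m
      (fun z => stepUpRule (oracleStat prob f₀ f₁ m z) γ α) (δ m)) atTop (𝓝 0)) :
    Tendsto (fun m => regret P θ Z m
      (fun z => randomizedRule (oracleStat prob f₀ f₁ m z) γ α) (δ m)) atTop (𝓝 0) := by
  have hor (m : ℕ) : IsRule fun z => stepUpRule (oracleStat prob f₀ f₁ m z) γ α :=
    isRule_stepUpRule (measurable_oracleStat hf₀ hf₁ m) γ α
  have hrand (m : ℕ) : IsRule fun z => randomizedRule (oracleStat prob f₀ f₁ m z) γ α :=
    isRule_randomizedRule (measurable_oracleStat hf₀ hf₁ m) γ hα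
  have h1 : Tendsto (fun m => regret P θ Z m
      (fun z => randomizedRule (oracleStat prob f₀ f₁ m z) γ α)
      (fun z => stepUpRule (oracleStat prob f₀ f₁ m z) γ α)) atTop (𝓝 0) := by
    refine squeeze_zero_norm (fun m => ?_) (tendsto_inv_atTop_nhds_zero_nat (𝕜 := ℝ))
    have := hM.abs_regret_le hprob hf₀ hf₁ (hrand m) (hor m) (integrable_const (1 : ℝ))
      fun ω => abs_sum_randomizedRule_sub_le
        (oracleStat_mem_Icc hprob hf₀ hf₁ (sample Z m ω)) γ hα
    simpa using this
  have h2 := h1.add h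
  rw [add_zero] at h2
  refine h2.congr fun m => ?_
  rw [hM.regret_eq (hrand m) (hor m), hM.regret_eq (hor m) (hδ m), hM.regret_eq (hrand m) (hδ m)]
  ring

/-- The relaxed data-driven procedure has at least a constant times `m` expected true positives. -/
lemma IsTwoGroupModel.exists_le_etp_relaxedRule (hM : IsTwoGroupModel P prob f₀ f₁ θ Z)
    (hprob : prob ∈ Set.Icc (0 : ℝ) 1) (hf₀ : IsDensity f₀) (hf₁ : IsDensity f₁)
    (hThat : IsLfdrEstimator That) (hcons : IsConsistent P Z prob f₀ f₁ That)
    (hγ : γ ∈ Set.Ioo (0 : ℝ) 1) (hα : α ∈ Set.Ioo (0 : ℝ) 1)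
    (hpos : 0 < P {ω | lfdr prob f₀ f₁ (Z 0 ω) < γ}) (hη : ∀ m, 0 ≤ η m)
    (hη0 : Tendsto η atTop (𝓝 0)) :
    ∃ κ > 0, ∀ᶠ m : ℕ in atTop,
      κ * m ≤ etp P θ Z m (fun z => relaxedRule (That m z) γ α (η m)) := by
  obtain ⟨c, hc, hgood⟩ :=
    hM.exists_goodEvents hprob hf₀ hf₁ hThat hcons hγ hα hpos hη hη0
  have hγ1 : 0 < 1 - γ := by linarith [hγ.2]
  -- Off the bad event the conditional mean is at least `(1 - γ) * (c * m) - κ * m = κ * m`;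
  -- probability at least one half then leaves `κ / 2`.
  set κ : ℝ := (1 - γ) * c / 2 with hκdef
  have hκ : 0 < κ := by positivity
  obtain ⟨bad, hbadm, hbad0, hev⟩ := hgood κ hκ
  refine ⟨κ / 2, by positivity, ?_⟩
  filter_upwards [hev, hbad0.eventually_le_const (show (0 : ℝ) < 1 / 2 by positivity)] with m hm hb
  have hm0 : (0 : ℝ) ≤ m := Nat.cast_nonneg m
  have hrel := isRule_relaxedRule (γ := γ) (α := α) hThat hγ.1 hα.1.le hη m
  have hind : Integrable ((bad m)ᶜ.indicator fun _ => κ * (m : ℝ)) P :=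
    (integrable_const _).indicator (hbadm m).compl
  rw [hM.etp_eq hprob hf₀ hf₁ hrel]
  calc κ / 2 * m ≤ P.real (bad m)ᶜ * (κ * m) := by
        rw [probReal_compl_eq_one_sub (hbadm m)]
        nlinarith [mul_nonneg hκ.le hm0]
    _ = ∫ ω, (bad m)ᶜ.indicator (fun _ => κ * (m : ℝ)) ω ∂P := by
        rw [integral_indicator_const _ (hbadm m).compl, smul_eq_mul]
    _ ≤ _ := by
        refine integral_mono hind (integrable_finsetSum _ fun i _ =>
          hM.integrable_stat_mul hprob hf₀ hf₁ hrel i) fun ω => ?_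
        by_cases hω : ω ∈ bad m
        · rw [Set.indicator_of_notMem (by simpa using hω)]
          exact Finset.sum_nonneg fun i _ => mul_nonneg
            (sub_nonneg.2 (oracleStat_mem_Icc hprob hf₀ hf₁ _ i).2) (hrel.mem_Icc _ i).1
        · rw [Set.indicator_of_mem (by simpa using hω)]
          obtain ⟨-, h2, h3⟩ := hm ω hω
          have hsplit : ∑ i, (1 - oracleStat prob f₀ f₁ m (sample Z m ω) i) *
              relaxedRule (That m (sample Z m ω)) γ α (η m) i =
              (1 - γ) * ∑ i, relaxedRule (That m (sample Z m ω)) γ α (η m) i -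
              ∑ i, (oracleStat prob f₀ f₁ m (sample Z m ω) i - γ) *
                relaxedRule (That m (sample Z m ω)) γ α (η m) i := by
            rw [Finset.mul_sum, ← Finset.sum_sub_distrib]
            exact Finset.sum_congr rfl fun i _ => by ring
          rw [hsplit]
          have h4 := mul_le_mul_of_nonneg_left h2 hγ1.le
          have h5 : (1 - γ) * (c * m) = 2 * κ * m := by rw [hκdef]; ring
          linarith

/-- The false discovery proportion of the relaxed data-driven procedure exceeds `γ + ε` with
vanishing probability. -/
lemma IsTwoGroupModel.tendsto_measure_fdp_relaxedRule (hM : IsTwoGroupModel P prob f₀ f₁ θ Z)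
    (hprob : prob ∈ Set.Icc (0 : ℝ) 1) (hf₀ : IsDensity f₀) (hf₁ : IsDensity f₁)
    (hThat : IsLfdrEstimator That) (hcons : IsConsistent P Z prob f₀ f₁ That)
    (hγ : γ ∈ Set.Ioo (0 : ℝ) 1) (hα : α ∈ Set.Ioo (0 : ℝ) 1)
    (hpos : 0 < P {ω | lfdr prob f₀ f₁ (Z 0 ω) < γ}) (hη : ∀ m, 0 ≤ η m)
    (hη0 : Tendsto η atTop (𝓝 0)) {ε : ℝ} (hε : 0 < ε) :
    Tendsto (fun m => P.real {ω | γ + ε ≤ fdp (sample θ m ω)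
      (relaxedRule (That m (sample Z m ω)) γ α (η m))}) atTop (𝓝 0) := by
  obtain ⟨c, hc, hgood⟩ :=
    hM.exists_goodEvents hprob hf₀ hf₁ hThat hcons hγ hα hpos hη hη0
  -- Reaching `γ + ε` needs a surplus `ε * (c * m) = 2 * (s * m)` of false positives; the excess
  -- explains at most `s * m`, so the noise `-V` must supply the rest.
  set s : ℝ := ε * c / 2 with hsdef
  have hs : 0 < s := by positivity
  obtain ⟨bad, hbadm, hbad0, hev⟩ := hgood s hs
  have hlim : Tendsto (fun m : ℕ => P.real (bad m) + 1 / s ^ 2 * (m : ℝ)⁻¹) atTop (𝓝 0) := by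
    have h := hbad0.add ((tendsto_inv_atTop_nhds_zero_nat (𝕜 := ℝ)).const_mul (1 / s ^ 2))
    rwa [mul_zero, add_zero] at h
  refine squeeze_zero' (Eventually.of_forall fun _ => measureReal_nonneg) ?_ hlim
  filter_upwards [hev, eventually_gt_atTop 0] with m hm hm0
  have hmpos : (0 : ℝ) < m := by exact_mod_cast hm0
  have hrel := isRule_relaxedRule (γ := γ) (α := α) hThat hγ.1 hα.1.le hη m
  obtain ⟨hint, hle⟩ := hM.integral_sq_residual_le hprob hf₀ hf₁ hrel
  set V : Ω → ℝ := fun ω => ∑ i : Fin m, (θ i ω - (1 - lfdr prob f₀ f₁ (Z i ω))) *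
    relaxedRule (That m (sample Z m ω)) γ α (η m) i with hV
  have hmarkov : P.real {ω | (s * m) ^ 2 ≤ V ω ^ 2} ≤ 1 / s ^ 2 * (m : ℝ)⁻¹ := by
    have h := mul_meas_ge_le_integral_of_nonneg
      (Eventually.of_forall fun ω => sq_nonneg (V ω)) hint ((s * m) ^ 2)
    have h2 := h.trans hle
    have h3 : 1 / s ^ 2 * (m : ℝ)⁻¹ = m / (s * m) ^ 2 := by field_simp
    rw [h3, le_div_iff₀ (by positivity), mul_comm]
    exact h2
  refine (measureReal_mono (s₂ := bad m ∪ {ω | (s * m) ^ 2 ≤ V ω ^ 2}) ?_).trans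
    ((measureReal_union_le _ _).trans (add_le_add le_rfl hmarkov))
  intro ω hω
  by_cases hωb : ω ∈ bad m
  · exact Or.inl hωb
  refine Or.inr ?_
  simp only [Set.mem_ofPred_eq] at hω ⊢
  obtain ⟨-, h2, h3⟩ := hm ω hωb
  set δ := relaxedRule (That m (sample Z m ω)) γ α (η m) with hδ
  -- The number of rejections is a positive integer, so the maximum with `1` in `fdp` disappears.
  have hK : 1 ≤ ∑ i, δ i := by
    have h4 : 0 < ∑ i, δ i := (by positivity : (0 : ℝ) < c * m).trans_le h2
    rw [hδ, relaxedRule_eq hThat hγ.1 hα.1.le hη, sum_topRule _ (stepUpCount_le _ _ _)] at h4 ⊢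
    exact_mod_cast h4
  rw [fdp, max_eq_left hK, le_div_iff₀ (by linarith)] at hω
  have hsplit : ∑ i, (1 - sample θ m ω i) * δ i = -V ω + γ * ∑ i, δ i +
      ∑ i, (oracleStat prob f₀ f₁ m (sample Z m ω) i - γ) * δ i := by
    rw [hV, Finset.mul_sum, ← Finset.sum_neg_distrib, ← Finset.sum_add_distrib,
      ← Finset.sum_add_distrib]
    exact Finset.sum_congr rfl fun i _ => by simp only [sample, oracleStat, ← hδ]; ring
  have h5 : ε * (c * m) ≤ ε * ∑ i, δ i := mul_le_mul_of_nonneg_left h2 hε.le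
  have h6 : ε * (c * m) = 2 * (s * m) := by rw [hsdef]; ring
  have h7 : s * m ≤ -V ω := by linarith
  rw [← neg_sq (V ω)]
  gcongr

/-- Vanishing scaled regret against a rule of linear expected true positives means asymptotically
equivalent expected true positives. -/
lemma IsTwoGroupModel.etp_isEquivalent (hM : IsTwoGroupModel P prob f₀ f₁ θ Z)
    {δ δ' : (m : ℕ) → (Fin m → ℝ) → Fin m → ℝ} (hδ : ∀ m, IsRule (δ m))
    (hδ' : ∀ m, IsRule (δ' m))
    (h : Tendsto (fun m => regret P θ Z m (δ m) (δ' m)) atTop (𝓝 0)) {κ : ℝ} (hκ : 0 < κ)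
    (hlow : ∀ᶠ m : ℕ in atTop, κ * m ≤ etp P θ Z m (δ' m)) :
    (fun m => etp P θ Z m (δ m)) ~[atTop] fun m => etp P θ Z m (δ' m) := by
  rw [IsEquivalent, isLittleO_iff]
  intro e he
  have h1 := (tendsto_zero_iff_abs_tendsto_zero _).1 h
  filter_upwards [h1.eventually_le_const (show 0 < e * κ by positivity), hlow,
    eventually_gt_atTop 0] with m hm hl hm0
  have hmpos : (0 : ℝ) < m := by exact_mod_cast hm0
  simp only [Function.comp_apply] at hm
  rw [hM.regret_eq (hδ m) (hδ' m), abs_mul, abs_of_pos (by positivity : (0 : ℝ) < (m : ℝ)⁻¹),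
    inv_mul_le_iff₀ hmpos] at hm
  simp only [Pi.sub_apply, Real.norm_eq_abs]
  calc _ ≤ m * (e * κ) := hm
    _ = e * (κ * m) := by ring
    _ ≤ e * |etp P θ Z m (δ' m)| := mul_le_mul_of_nonneg_left (hl.trans (le_abs_self _)) he.le

end Relaxed

end FDX

theorem proposition5 {Ω : Type*} [MeasurableSpace Ω] (P : Measure Ω) [IsProbabilityMeasure P]
    (prob : ℝ) (hprob : prob ∈ Set.Icc (0 : ℝ) 1)
    (f₀ f₁ : ℝ → ℝ) (hf₀ : FDX.IsDensity f₀) (hf₁ : FDX.IsDensity f₁)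
    (θ Z : ℕ → Ω → ℝ) (hmodel : FDX.IsTwoGroupModel P prob f₀ f₁ θ Z)
    (That : (m : ℕ) → (Fin m → ℝ) → Fin m → ℝ) (hThat : FDX.IsLfdrEstimator That)
    (hcons : FDX.IsConsistent P Z prob f₀ f₁ That)
    (γ α : ℝ) (hγ : γ ∈ Set.Ioo (0 : ℝ) 1) (hα : α ∈ Set.Ioo (0 : ℝ) 1) :
    -- top-k selection by the estimated lfdr has vanishing scaled regret, for any data-driven k
    (∀ k : (m : ℕ) → (Fin m → ℝ) → ℕ, (∀ m, Measurable (k m)) →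
      Tendsto (fun m => FDX.regret P θ Z m
        (fun z => FDX.topRule (FDX.oracleStat prob f₀ f₁ m z) (k m z))
        (fun z => FDX.topRule (That m z) (k m z))) atTop (𝓝 0)) ∧
    -- the relaxed data-driven procedure
    (0 < P {ω | FDX.lfdr prob f₀ f₁ (Z 0 ω) < γ} →
      ∀ η : ℕ → ℝ, (∀ m, 0 ≤ η m) → Tendsto η atTop (𝓝 0) →
        -- is asymptotically valid
        (∀ ε : ℝ, 0 < ε → ∃ r : ℕ → ℝ, Tendsto r atTop (𝓝 0) ∧ ∀ m,
          P.real {ω | γ + ε ≤ FDX.fdp (FDX.sample θ m ω)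
            (FDX.relaxedRule (That m (FDX.sample Z m ω)) γ α (η m))} ≤ α + r m) ∧
        -- attains the ETP of the oracle procedure, without and with randomization, up to 1 + o(1)
        ((fun m => FDX.etp P θ Z m
            (fun z => FDX.stepUpRule (FDX.oracleStat prob f₀ f₁ m z) γ α)) ~[atTop]
          (fun m => FDX.etp P θ Z m (fun z => FDX.relaxedRule (That m z) γ α (η m)))) ∧
        ((fun m => FDX.etp P θ Z m
            (fun z => FDX.randomizedRule (FDX.oracleStat prob f₀ f₁ m z) γ α)) ~[atTop]
          (fun m => FDX.etp P θ Z m (fun z => FDX.relaxedRule (That m z) γ α (η m)))) ∧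
        -- and has vanishing scaled regret against the oracle procedure
        Tendsto (fun m => FDX.regret P θ Z m
          (fun z => FDX.stepUpRule (FDX.oracleStat prob f₀ f₁ m z) γ α)
          (fun z => FDX.relaxedRule (That m z) γ α (η m))) atTop (𝓝 0) ∧
        Tendsto (fun m => FDX.regret P θ Z m
          (fun z => FDX.randomizedRule (FDX.oracleStat prob f₀ f₁ m z) γ α)
          (fun z => FDX.relaxedRule (That m z) γ α (η m))) atTop (𝓝 0)) := by

  refine ⟨fun k hk => hmodel.tendsto_regret_topRule hprob hf₀ hf₁ hThat hcons hk,
    fun hpos η hη hη0 => ?_⟩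
  have hα0 := hα.1.le
  have hstep := hmodel.tendsto_regret_stepUpRule hprob hf₀ hf₁ hThat hcons hγ hα hpos hη hη0
  have hrel := FDX.isRule_relaxedRule (γ := γ) (α := α) hThat hγ.1 hα0 hη
  have hrand := hmodel.tendsto_regret_randomizedRule hprob hf₀ hf₁ hα0 hrel hstep
  obtain ⟨κ, hκ, hlow⟩ :=
    hmodel.exists_le_etp_relaxedRule hprob hf₀ hf₁ hThat hcons hγ hα hpos hη hη0
  have hT := FDX.measurable_oracleStat (prob := prob) hf₀ hf₁
  -- The exceedance probability itself tends to zero, so it serves as `r`.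
  refine ⟨fun ε hε => ⟨_, hmodel.tendsto_measure_fdp_relaxedRule hprob hf₀ hf₁ hThat hcons hγ hα
    hpos hη hη0 hε, fun m => le_add_of_nonneg_left hα0⟩, ?_, ?_, hstep, hrand⟩
  · exact hmodel.etp_isEquivalent (fun m => FDX.isRule_stepUpRule (hT m) γ α) hrel hstep hκ hlow
  · exact hmodel.etp_isEquivalent (fun m => FDX.isRule_randomizedRule (hT m) γ hα0) hrel hrand hκ
      hlow
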